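/- **Notation.** Let $\mathcal P$ be the set of all partitions, including the empty partition of $0$. For $\mu=(\mu_1\ge\dots\ge\mu_l>0)\in\mathcal P$ write $|\mu|=\sum_i\mu_i$, $l(\mu)=l$, $m_j(\mu)$ for the number of parts equal to $j$, $z_\mu=\prod_j m_j(\mu)!\,j^{m_j(\mu)}$, $\kappa_\mu=\sum_{i=1}^{l(\mu)}\mu_i(\mu_i-2i+1)$, and $\mu'$ for the transposed partition. For $|\mu|=|\nu|=d$ let $\chi_\nu(\mu)$ be the value of the irreducible character of $S_d$ labelled by $\nu$ (with $\nu=(d)$ the trivial and $\nu=(1^d)$ the sign character) on the class of cycle type $\mu$. Let $\lambda\in\mathbb C$ be such that $q=e^{\sqrt{-1}\lambda}$ is not a root of unity, put $q^{r}=e^{\sqrt{-1}\lambda r}$ and $[m]=q^{m/2}-q^{-m/2}$, and let $$\mathcal W_\mu=q^{\kappa_\mu/4}\prod_{1\le i<j\le l(\mu)}\frac{[\mu_i-\mu_j+j-i]}{[j-i]}\prod_{i=1}^{l(\mu)}\prod_{v=1}^{\mu_i}\frac1{[v-i+l(\mu)]},$$ $$\mathcal E_\mu(t)=\prod_{j=1}^{l(\mu)}\frac{1+q^{\mu_j-j}t}{1+q^{-j}t}\cdot\Big(1+\sum_{n\ge1}\frac{t^n}{\prod_{i=1}^n(q^i-1)}\Big),\qquad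 \mathcal W_{\mu,\nu}=q^{|\nu|/2}\,\mathcal W_\mu\, s_\nu(\mathcal E_\mu(t)),$$ where $s_\nu\big(\sum_n e_nt^n\big)=\det(e_{\nu'_i-i+j})_{1\le i,j\le l(\nu')}$ with $e_n=0$ for $n<0$. Let $p^+_1,p^+_2,\dots,p^-_1,p^-_2,\dots$ be independent variables, $p^\pm_\mu=\prod_i p^\pm_{\mu_i}$. For $\tau\in\mathbb C\setminus\{0\}$ define the formal power series in the $p^\pm_n$ $$R(\tau)^\bullet=\sum_{|\mu^\pm|=|\nu^\pm|\ge0}\frac{\chi_{\nu^+}(\mu^+)}{z_{\mu^+}}\frac{\chi_{\nu^-}(\mu^-)}{z_{\mu^-}}\,e^{\sqrt{-1}\left(\kappa_{\nu^+}\tau+\frac{\kappa_{\nu^-}}{\tau}\right)\lambda/2}\,\mathcal W_{\nu^+,\nu^-}\,p^+_{\mu^+}p^-_{\mu^-},$$ the sum being over all $\mu^+,\nu^+,\mu^-,\nu^-\in\mathcal P$ with $|\mu^+|=|\nu^+|$ and $|\mu^-|=|\nu^-|$. **Theorem.** For every $\tau\neq0$, $R(\tau)^\bullet$ satisfies the cut-and-join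 equation $$\frac{\partial}{\partial\tau}R(\tau)^\bullet=\frac{\sqrt{-1}\,\lambda}{2}\,(C^++J^+)R(\tau)^\bullet-\frac{\sqrt{-1}\,\lambda}{2\tau^2}\,(C^-+J^-)R(\tau)^\bullet,$$ where $\partial/\partial\tau$ is taken coefficientwise and $$C^\pm=\sum_{i,j\ge1}(i+j)\,p^\pm_ip^\pm_j\frac{\partial}{\partial p^\pm_{i+j}},\qquad J^\pm=\sum_{i,j\ge1}ij\,p^\pm_{i+j}\frac{\partial^2}{\partial p^\pm_i\,\partial p^\pm_j}.$$ -/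

import Mathlib

noncomputable section

namespace TwoPartition

open Finset

/-! Partitions (including the empty partition of `0`) are Young diagrams in English notation.  Rows
are numbered from `0`, so the part `μ_{i+1}` is `μ.rowLen i`, and `|μ| = μ.card`. -/

/-- The number of parts `l(μ)`. -/
def length (μ : YoungDiagram) : ℕ := μ.colLen 0

/-- `z_μ = ∏_j m_j(μ)! j^{m_j(μ)}`, where `m_j(μ)` is the number of parts equal to `j`. -/
def zFactor (μ : YoungDiagram) : ℕ :=
  ∏ j ∈ μ.rowLens.toFinset, (μ.rowLens.count j).factorial * j ^ μ.rowLens.count j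

/-- `κ_μ = ∑_i μ_i (μ_i - 2 i + 1)`, with `i` counted from `1`. -/
def kappa (μ : YoungDiagram) : ℤ :=
  ∑ i ∈ range (length μ), (μ.rowLen i : ℤ) * ((μ.rowLen i : ℤ) - 2 * ((i : ℤ) + 1) + 1)

theorem card_eq_sum_rowLen (μ : YoungDiagram) :
    μ.card = ∑ i ∈ range (length μ), μ.rowLen i := by
  rw [YoungDiagram.card, Finset.card_eq_sum_card_fiberwise (f := Prod.fst)
    (t := range (length μ))]
  · exact Finset.sum_congr rfl fun i _ => (μ.rowLen_eq_card (i := i)).symm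
  · rintro ⟨i, j⟩ h
    have h1 : (i, j) ∈ μ := h
    have h2 : (i, 0) ∈ μ := μ.up_left_mem le_rfl (Nat.zero_le j) h1
    simpa [length] using YoungDiagram.mem_iff_lt_colLen.1 h2

theorem sum_rowLens (μ : YoungDiagram) : μ.rowLens.sum = μ.card := by
  rw [card_eq_sum_rowLen, YoungDiagram.rowLens, length, Finset.sum_range, ← List.sum_ofFn]
  congr 1
  apply List.ext_getElem <;> simp

/-! ### Irreducible characters of the symmetric group -/

/-- The standard bijective filling of the boxes of `ν` by the numbers `0, …, |ν| - 1`; the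
isomorphism class of the representation below does not depend on which bijection is used. -/
def filling (ν : YoungDiagram) : Fin ν.card ≃ ν.cells := ν.cells.equivFin.symm

/-- The permutations that preserve every row of the filled diagram. -/
def rowStabilizer (ν : YoungDiagram) : Finset (Equiv.Perm (Fin ν.card)) :=
  univ.filter fun σ => ∀ k, (filling ν (σ k)).1.1 = (filling ν k).1.1

/-- The permutations that preserve every column of the filled diagram. -/
def colStabilizer (ν : YoungDiagram) : Finset (Equiv.Perm (Fin ν.card)) :=
  univ.filter fun σ => ∀ k, (filling ν (σ k)).1.2 = (filling ν k).1.2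

/-- The Young symmetrizer `c_ν = (∑_{σ preserves rows} σ) (∑_{σ preserves columns} sgn(σ) σ)`. -/
def youngSymmetrizer (ν : YoungDiagram) : MonoidAlgebra ℂ (Equiv.Perm (Fin ν.card)) :=
  (∑ σ ∈ rowStabilizer ν, MonoidAlgebra.of ℂ _ σ) *
    ∑ σ ∈ colStabilizer ν, ((Equiv.Perm.sign σ : ℤ) : ℂ) • MonoidAlgebra.of ℂ _ σ

/-- The irreducible representation `R_ν` of the symmetric group on `|ν|` letters: the left ideal of
the group algebra generated by the Young symmetrizer.  For `ν = (d)` it is the trivial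
representation and for `ν = (1^d)` the sign representation. -/
abbrev Irrep (ν : YoungDiagram) : Ideal (MonoidAlgebra ℂ (Equiv.Perm (Fin ν.card))) :=
  Ideal.span {youngSymmetrizer ν}

/-- The character of `R_ν`: the trace of the left multiplication by `σ`. -/
def irrepCharacter (ν : YoungDiagram) (σ : Equiv.Perm (Fin ν.card)) : ℂ :=
  LinearMap.trace ℂ (Irrep ν) (Algebra.lsmul ℂ ℂ (Irrep ν) (MonoidAlgebra.of ℂ _ σ))

/-- For `|μ| = |ν|` there is a permutation of `|ν|` letters whose cycle lengths are the parts of `μ`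
(Mathlib's `cycleType` lists the cycles of length at least two). -/
theorem exists_perm (ν μ : YoungDiagram) (h : μ.card = ν.card) :
    ∃ σ : Equiv.Perm (Fin ν.card),
      σ.cycleType = (μ.rowLens : Multiset ℕ).filter (2 ≤ ·) := by
  rw [Equiv.Perm.exists_with_cycleType_iff]
  refine ⟨?_, fun a ha => (Multiset.mem_filter.1 ha).2⟩
  have h1 := congrArg Multiset.sum
    (Multiset.filter_add_not (fun k => 2 ≤ k) (μ.rowLens : Multiset ℕ))
  rw [Multiset.sum_add, Multiset.sum_coe, sum_rowLens, h] at h1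
  rw [Fintype.card_fin]
  omega

/-- `χ_ν(μ)`, for `|μ| = |ν|`: the value of the character of `R_ν` on the conjugacy class of the
permutations with cycle lengths `μ_1, μ_2, …`. -/
def chi (ν μ : YoungDiagram) (h : μ.card = ν.card) : ℂ :=
  irrepCharacter ν (exists_perm ν μ h).choose

/-! ### The functions `𝒲`, with `q = e^{√-1 λ}` -/

/-- `q^r = e^{√-1 λ r}`. -/
def qPow (lam r : ℂ) : ℂ := Complex.exp (Complex.I * lam * r)

/-- `[m] = q^{m/2} - q^{-m/2}`. -/
def bracket (lam : ℂ) (m : ℤ) : ℂ := qPow lam ((m : ℂ) / 2) - qPow lam (-(m : ℂ) / 2)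

/-- `𝒲_μ = q^{κ_μ/4} ∏_{i<j} [μ_i - μ_j + j - i]/[j - i] ∏_i ∏_{v=1}^{μ_i} 1/[v - i + l(μ)]`. -/
def W₁ (lam : ℂ) (μ : YoungDiagram) : ℂ :=
  qPow lam ((kappa μ : ℂ) / 4) *
    (∏ i ∈ range (length μ), ∏ j ∈ Ioo i (length μ),
      bracket lam ((μ.rowLen i : ℤ) - μ.rowLen j + j - i) / bracket lam ((j : ℤ) - i)) *
    ∏ i ∈ range (length μ), ∏ v ∈ Icc 1 (μ.rowLen i),
      1 / bracket lam ((v : ℤ) - ((i : ℤ) + 1) + length μ)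

/-- `ℰ_μ(t) = ∏_{j=1}^{l(μ)} (1 + q^{μ_j - j} t)/(1 + q^{-j} t) ·
(1 + ∑_{n ≥ 1} t^n / ∏_{i=1}^n (q^i - 1))`. -/
def E (lam : ℂ) (μ : YoungDiagram) : PowerSeries ℂ :=
  (∏ j ∈ range (length μ),
    (1 + PowerSeries.C (qPow lam ((μ.rowLen j : ℂ) - ((j : ℂ) + 1))) * PowerSeries.X) *
      (1 + PowerSeries.C (qPow lam (-((j : ℂ) + 1))) * PowerSeries.X)⁻¹) *
    PowerSeries.mk fun n => 1 / ∏ i ∈ Icc 1 n, (qPow lam (i : ℂ) - 1)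

/-- The Schur function `s_ν` evaluated where the generating series of the elementary symmetric
functions is `F = ∑_n e_n t^n`: the determinant of `(e_{ν'_i - i + j})`, of size `l(ν')`, with
`e_n = 0` for `n < 0`. -/
def schurEval (ν : YoungDiagram) (F : PowerSeries ℂ) : ℂ :=
  Matrix.det (Matrix.of fun i j : Fin (ν.rowLen 0) =>
    if 0 ≤ (ν.colLen i : ℤ) - (i : ℤ) + (j : ℤ) then
      PowerSeries.coeff ((ν.colLen i : ℤ) - (i : ℤ) + (j : ℤ)).toNat F
    else 0)

/-- `𝒲_{μ,ν} = q^{|ν|/2} 𝒲_μ s_ν(ℰ_μ(t))`. -/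
def W₂ (lam : ℂ) (μ ν : YoungDiagram) : ℂ :=
  qPow lam ((ν.card : ℂ) / 2) * W₁ lam μ * schurEval ν (E lam μ)

/-! ### Formal power series in the variables `p^±_1, p^±_2, …` -/

/-- The index set of the variables: `Sum.inl n` stands for `p^+_n`, `Sum.inr n` for `p^-_n`. -/
abbrev Var : Type := ℕ+ ⊕ ℕ+

/-- The ring of formal power series in the variables `p^±_n`. -/
abbrev Series : Type := MvPowerSeries Var ℂ

/-- The formal sum of a family of series: every coefficient is summed separately (each of these sums
is finite for all the families below). -/
def formalSum {ι : Type} (f : ι → Series) : Series :=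
  fun m => ∑ᶠ i, MvPowerSeries.coeff m (f i)

/-- A family in which every monomial occurs in only finitely many members. -/
def LocallyFinite {ι : Type} (f : ι → Series) : Prop :=
  ∀ m, {i | MvPowerSeries.coeff m (f i) ≠ 0}.Finite

/-- The monomial `p_μ = p_{μ_1} p_{μ_2} ⋯` in the variables `p_n` selected by `v`. -/
def pMonomial (v : ℕ+ → Var) (μ : YoungDiagram) : Series :=
  ∏ i ∈ range (length μ), MvPowerSeries.X (v (μ.rowLen i).toPNat')

/-- Quadruples `((μ⁺, ν⁺), (μ⁻, ν⁻))` of partitions with `|μ⁺| = |ν⁺|` and `|μ⁻| = |ν⁻|`. -/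
abbrev Quadruple : Type :=
  {x : (YoungDiagram × YoungDiagram) × (YoungDiagram × YoungDiagram) //
    x.1.1.card = x.1.2.card ∧ x.2.1.card = x.2.2.card}

/-- The summand of `R(τ)^•` that belongs to a quadruple of partitions. -/
def RTerm (lam tau : ℂ) (x : Quadruple) : Series :=
  ((chi x.1.1.2 x.1.1.1 x.2.1 / zFactor x.1.1.1) *
    (chi x.1.2.2 x.1.2.1 x.2.2 / zFactor x.1.2.1) *
    Complex.exp (Complex.I * (kappa x.1.1.2 * tau + kappa x.1.2.2 / tau) * lam / 2) *
    W₂ lam x.1.1.2 x.1.2.2) •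
      (pMonomial Sum.inl x.1.1.1 * pMonomial Sum.inr x.1.2.1)

/-- `R(τ)^•`, the sum over all partitions with `|μ^±| = |ν^±| ≥ 0` of
`χ_{ν⁺}(μ⁺)/z_{μ⁺} · χ_{ν⁻}(μ⁻)/z_{μ⁻} · e^{√-1 (κ_{ν⁺} τ + κ_{ν⁻}/τ) λ/2} 𝒲_{ν⁺,ν⁻} p⁺_{μ⁺} p⁻_{μ⁻}`. -/
def R (lam tau : ℂ) : Series := formalSum (RTerm lam tau)

/-- The summands of the cut operator. -/
def cutTerm (v : ℕ+ → Var) (f : Series) (ij : ℕ+ × ℕ+) : Series :=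
  (((ij.1 + ij.2 : ℕ+) : ℕ) : ℂ) •
    (MvPowerSeries.X (v ij.1) * MvPowerSeries.X (v ij.2) *
      MvPowerSeries.pderiv ℂ (v (ij.1 + ij.2)) f)

/-- The cut operator `∑_{i,j ≥ 1} (i + j) p_i p_j ∂/∂p_{i+j}`. -/
def cut (v : ℕ+ → Var) (f : Series) : Series := formalSum (cutTerm v f)

/-- The summands of the join operator. -/
def joinTerm (v : ℕ+ → Var) (f : Series) (ij : ℕ+ × ℕ+) : Series :=
  (((ij.1 : ℕ) : ℂ) * ((ij.2 : ℕ) : ℂ)) •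
    (MvPowerSeries.X (v (ij.1 + ij.2)) *
      MvPowerSeries.pderiv ℂ (v ij.1) (MvPowerSeries.pderiv ℂ (v ij.2) f))

/-- The join operator `∑_{i,j ≥ 1} i j p_{i+j} ∂²/∂p_i ∂p_j`. -/
def join (v : ℕ+ → Var) (f : Series) : Series := formalSum (joinTerm v f)

/-! ### The formal sums above are locally finite -/

theorem ne_zero_of_coeff_X_mul {x : Var} {g : Series} {m : Var →₀ ℕ}
    (h : MvPowerSeries.coeff m (MvPowerSeries.X x * g) ≠ 0) : m x ≠ 0 := by
  classical
  intro h0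
  apply h
  rw [MvPowerSeries.X, MvPowerSeries.coeff_monomial_mul, if_neg]
  intro hle
  have := hle x
  simp [h0] at this

theorem locallyFinite_cut {v : ℕ+ → Var} (hv : Function.Injective v) (f : Series) :
    LocallyFinite (cutTerm v f) := by
  intro m
  have hfin : (v ⁻¹' (m.support : Set Var)).Finite :=
    m.support.finite_toSet.preimage hv.injOn
  refine (hfin.prod hfin).subset ?_
  rintro ⟨i, j⟩ h
  have h1 : MvPowerSeries.coeff m (MvPowerSeries.X (v i) * MvPowerSeries.X (v j) *
      MvPowerSeries.pderiv ℂ (v (i + j)) f) ≠ 0 := by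
    intro h0
    apply h
    simp [cutTerm, h0]
  constructor
  · rw [mul_assoc] at h1
    simpa using ne_zero_of_coeff_X_mul h1
  · rw [mul_comm (MvPowerSeries.X (v i)), mul_assoc] at h1
    simpa using ne_zero_of_coeff_X_mul h1

theorem locallyFinite_join {v : ℕ+ → Var} (hv : Function.Injective v) (f : Series) :
    LocallyFinite (joinTerm v f) := by
  intro m
  have hfin : (v ⁻¹' (m.support : Set Var)).Finite :=
    m.support.finite_toSet.preimage hv.injOn
  obtain ⟨N, hN⟩ := hfin.bddAbove
  refine ((Set.finite_Iic N).prod (Set.finite_Iic N)).subset ?_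
  rintro ⟨i, j⟩ h
  have h1 : MvPowerSeries.coeff m (MvPowerSeries.X (v (i + j)) *
      MvPowerSeries.pderiv ℂ (v i) (MvPowerSeries.pderiv ℂ (v j) f)) ≠ 0 := by
    intro h0
    apply h
    simp [joinTerm, h0]
  have h2 : i + j ≤ N := hN (by simpa using ne_zero_of_coeff_X_mul h1)
  exact ⟨(PNat.lt_add_right i j).le.trans h2, (PNat.lt_add_left j i).le.trans h2⟩

theorem finite_card_le (n : ℕ) : {μ : YoungDiagram | μ.card ≤ n}.Finite := by
  refine Set.Finite.of_finite_image (f := YoungDiagram.cells) ?_ ?_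
  · refine (Finset.finite_toSet (range n ×ˢ range n).powerset).subset ?_
    rintro _ ⟨μ, hμ, rfl⟩
    simp only [Finset.coe_powerset, Set.mem_preimage, Set.mem_powerset_iff, Finset.coe_subset]
    rintro ⟨i, j⟩ hij
    have hm : (i, j) ∈ μ := hij
    have h1 : (range (i + 1)).image (fun a => (a, j)) ⊆ μ.cells := by
      intro c hc
      obtain ⟨a, ha, rfl⟩ := Finset.mem_image.1 hc
      exact μ.up_left_mem (Nat.lt_succ_iff.1 (Finset.mem_range.1 ha)) le_rfl hm
    have h2 : (range (j + 1)).image (fun b => (i, b)) ⊆ μ.cells := by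
      intro c hc
      obtain ⟨b, hb, rfl⟩ := Finset.mem_image.1 hc
      exact μ.up_left_mem le_rfl (Nat.lt_succ_iff.1 (Finset.mem_range.1 hb)) hm
    have h3 := Finset.card_le_card h1
    have h4 := Finset.card_le_card h2
    rw [Finset.card_image_of_injective _ (fun a b h => by simpa using h), card_range] at h3 h4
    have h5 : μ.cells.card ≤ n := hμ
    simp only [mem_product, mem_range]
    omega
  · intro μ _ ν _ h
    exact YoungDiagram.ext h

/-- The exponent of the monomial `p_μ`. -/
def pExponent (v : ℕ+ → Var) (μ : YoungDiagram) : Var →₀ ℕ :=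
  ∑ i ∈ range (length μ), Finsupp.single (v (μ.rowLen i).toPNat') 1

theorem pMonomial_eq (v : ℕ+ → Var) (μ : YoungDiagram) :
    pMonomial v μ = MvPowerSeries.monomial (pExponent v μ) 1 := by
  classical
  unfold pMonomial pExponent
  induction range (length μ) using Finset.induction_on with
  | empty => simp
  | insert a s ha ih =>
    rw [Finset.prod_insert ha, Finset.sum_insert ha, ih, MvPowerSeries.X,
      MvPowerSeries.monomial_mul_monomial, one_mul]

/-- The degree of a monomial when `p^±_n` has degree `n`. -/
def degree (m : Var →₀ ℕ) : ℕ := m.sum fun x k => k * Sum.elim PNat.val PNat.val x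

theorem degree_add (m n : Var →₀ ℕ) : degree (m + n) = degree m + degree n := by
  classical
  exact Finsupp.sum_add_index' (by simp) (fun a b c => by ring)

theorem degree_pExponent {v : ℕ+ → Var} (hv : ∀ n, Sum.elim PNat.val PNat.val (v n) = (n : ℕ))
    (μ : YoungDiagram) : degree (pExponent v μ) = μ.card := by
  classical
  have key : ∀ s ⊆ range (length μ),
      degree (∑ i ∈ s, Finsupp.single (v (μ.rowLen i).toPNat') 1) = ∑ i ∈ s, μ.rowLen i := by
    intro s
    induction s using Finset.induction_on with
    | empty => intro _; simp [degree]
    | insert a s ha ih =>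
      intro hs
      rw [Finset.sum_insert ha, Finset.sum_insert ha, degree_add,
        ih ((Finset.subset_insert a s).trans hs)]
      have h1 : a < μ.colLen 0 := by
        simpa [length] using hs (Finset.mem_insert_self a s)
      have h2 : 0 < μ.rowLen a :=
        YoungDiagram.mem_iff_lt_rowLen.1 (YoungDiagram.mem_iff_lt_colLen.2 h1)
      have h3 : ((μ.rowLen a).toPNat' : ℕ) = μ.rowLen a := PNat.toPNat'_coe h2
      simp [degree, Finsupp.sum_single_index, hv, h3]
  rw [card_eq_sum_rowLen]
  exact key _ Finset.Subset.rfl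

theorem locallyFinite_RTerm (lam tau : ℂ) : LocallyFinite (RTerm lam tau) := by
  classical
  intro m
  have hfin := finite_card_le (degree m)
  refine Set.Finite.of_finite_image (f := Subtype.val)
    (((hfin.prod hfin).prod (hfin.prod hfin)).subset ?_) Subtype.val_injective.injOn
  rintro _ ⟨⟨⟨⟨μ, ν⟩, μ', ν'⟩, hc, hc'⟩, h, rfl⟩
  have h1 : MvPowerSeries.coeff m (pMonomial Sum.inl μ * pMonomial Sum.inr μ') ≠ 0 := by
    intro h0
    apply h
    simp only [RTerm, MvPowerSeries.coeff_smul, h0, mul_zero]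
  rw [pMonomial_eq, pMonomial_eq, MvPowerSeries.monomial_mul_monomial,
    MvPowerSeries.coeff_monomial] at h1
  have h2 : m = pExponent Sum.inl μ + pExponent Sum.inr μ' := by
    by_contra hne
    exact h1 (if_neg hne)
  have h3 := congrArg degree h2
  rw [degree_add, degree_pExponent (fun _ => rfl), degree_pExponent (fun _ => rfl)] at h3
  have hc : μ.card = ν.card := hc
  have hc' : μ'.card = ν'.card := hc'
  have e1 : μ.card ≤ degree m := by omega
  have e2 : ν.card ≤ degree m := by omega
  have e3 : μ'.card ≤ degree m := by omega
  have e4 : ν'.card ≤ degree m := by omega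
  exact ⟨⟨e1, e2⟩, e3, e4⟩

end TwoPartition

end

/-!
Expanding in Schur functions `s_ν = ∑_μ χ_ν(μ) p_μ / z_μ`, the series `R(τ)^•` is a combination of
the products `s_{ν⁺}(p⁺) s_{ν⁻}(p⁻)` in which `τ` enters only through the exponential factor.
Differentiating that factor produces `√-1 λ/2 · (κ_{ν⁺} - κ_{ν⁻}/τ²)`, so the equation says that
`s_ν` is an eigenvector of the operator `C + J` with eigenvalue `κ_ν` (`cutJoin_schur_mul`); the
values of `𝒲_{ν⁺,ν⁻}` play no role.

The eigenvector property comes from the sum `T` of the transpositions `(x y)`, `x ≠ y`, in the group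
algebra of the symmetric group.

* `T` acts on `R_ν` by `κ_ν`.  As `T` is central, it is enough to compute `T a b = a T b` for the
  Young symmetrizer `a b`, where `a` sums over the row stabilizer and `b`, with signs, over the
  column stabilizer.  A transposition within a row is absorbed by `a`, one within a column is
  absorbed by `b` up to a sign, and `a (x y) b = 0` for all others.  What remains counts the pairs
  of boxes in a common row minus those in a common column, and this is `κ_ν`
  (`transpositionSum_mul_youngSymmetrizer`).  Taking traces,
  `∑_{x ≠ y} χ_ν((x y) σ) = κ_ν χ_ν(σ)` (`sum_irrepCharacter_swap_mul`).
* Multiplying `σ` by `(x y)` cuts the cycle through `x` and `y` in two or joins their two cycles.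
  Counting the pairs `x ≠ y` for every outcome shows that `C + J` maps the monomial `p_σ` of the
  cycle type of `σ` to `∑_{x ≠ y} p_{(x y) σ}` (`cutJoin_permMonomial_mul`).

Writing `s_ν` as the average of `χ_ν(σ) p_σ` over the symmetric group (`schur_eq_sum`, by the count
`d!/z_μ` of the permutations of cycle type `μ`) and reindexing by `σ ↦ (x y) σ` combines the two.

The series is infinite, but `C + J` preserves the degree in which `p_n` has degree `n`, and
only finitely many terms contribute in each degree (`coeff_cutJoin_R`).
-/

noncomputable section

namespace TwoPartition

open Finset Equiv

/-! ### The sum of all transpositions in the group algebra -/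

/-- The sum of the transpositions `(x y)` over all ordered pairs `x ≠ y`, in which every
transposition occurs twice. -/
def transpositionSum (α : Type*) [Fintype α] [DecidableEq α] : MonoidAlgebra ℂ (Perm α) :=
  ∑ x : α, ∑ y : α, if x = y then 0 else MonoidAlgebra.of ℂ _ (swap x y)

theorem transpositionSum_commute_of {α : Type*} [Fintype α] [DecidableEq α] (σ : Perm α) :
    Commute (transpositionSum α) (MonoidAlgebra.of ℂ _ σ) := by
  have h : MonoidAlgebra.of ℂ _ σ * transpositionSum α =
      transpositionSum α * MonoidAlgebra.of ℂ _ σ := by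
    simp only [transpositionSum, Finset.mul_sum, Finset.sum_mul]
    refine Fintype.sum_equiv σ _ _ fun x => Fintype.sum_equiv σ _ _ fun y => ?_
    simp only [σ.injective.eq_iff, mul_ite, ite_mul, mul_zero, zero_mul, ← map_mul,
      mul_swap_eq_swap_mul]
  exact h.symm

theorem transpositionSum_commute {α : Type*} [Fintype α] [DecidableEq α]
    (z : MonoidAlgebra ℂ (Perm α)) : Commute (transpositionSum α) z := by
  induction z using MonoidAlgebra.induction_on with
  | of σ => exact transpositionSum_commute_of σ
  | add f g hf hg => exact hf.add_right hg
  | smul r f hf => exact hf.smul_right r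

/-! ### Contents of a Young diagram -/

theorem sum_cells_eq_sum_rows {M : Type*} [AddCommMonoid M] (μ : YoungDiagram)
    (f : ℕ × ℕ → M) :
    ∑ c ∈ μ.cells, f c = ∑ i ∈ range (length μ), ∑ j ∈ range (μ.rowLen i), f (i, j) := by
  rw [Finset.sum_sigma']
  refine Finset.sum_nbij' (fun c => ⟨c.1, c.2⟩) (fun s => (s.1, s.2)) ?_ ?_ ?_ ?_ ?_
  · rintro ⟨i, j⟩ h
    have h1 : (i, j) ∈ μ := h
    have h2 : (i, 0) ∈ μ := μ.up_left_mem le_rfl (Nat.zero_le j) h1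
    simp only [mem_sigma, mem_range, length]
    exact ⟨YoungDiagram.mem_iff_lt_colLen.1 h2, YoungDiagram.mem_iff_lt_rowLen.1 h1⟩
  · rintro ⟨i, j⟩ h
    simp only [mem_sigma, mem_range] at h
    exact YoungDiagram.mem_iff_lt_rowLen.2 h.2
  all_goals intros; rfl

theorem sum_cells_transpose {M : Type*} [AddCommMonoid M] (μ : YoungDiagram) (f : ℕ × ℕ → M) :
    ∑ c ∈ μ.transpose.cells, f c = ∑ c ∈ μ.cells, f c.swap := by
  refine Finset.sum_nbij' Prod.swap Prod.swap ?_ ?_ ?_ ?_ ?_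
  · intro c h
    simpa using h
  · intro c h
    simpa using h
  all_goals simp

theorem sum_range_two_mul_add_one (n : ℕ) : ∑ i ∈ range n, (2 * (i : ℤ) + 1) = n * n := by
  induction n with
  | zero => simp
  | succ n ih => rw [Finset.sum_range_succ, ih]; push_cast; ring

/-- Both sides are `∑_j (μ'_j)²`. -/
theorem sum_cells_colLen (μ : YoungDiagram) :
    ∑ c ∈ μ.cells, (μ.colLen c.2 : ℤ) = ∑ c ∈ μ.cells, (2 * (c.1 : ℤ) + 1) := by
  have h := sum_cells_transpose (M := ℤ) μ.transpose
  rw [YoungDiagram.transpose_transpose] at h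
  rw [h, h, sum_cells_eq_sum_rows, sum_cells_eq_sum_rows]
  refine Finset.sum_congr rfl fun i _ => ?_
  simp [sum_range_two_mul_add_one]

/-- `κ_μ = ∑_i μ_i² - ∑_j (μ'_j)²`, written as a sum over the boxes. -/
theorem sum_cells_rowLen_sub_colLen (μ : YoungDiagram) :
    ∑ c ∈ μ.cells, ((μ.rowLen c.1 : ℤ) - μ.colLen c.2) = kappa μ := by
  rw [Finset.sum_sub_distrib, sum_cells_colLen, ← Finset.sum_sub_distrib,
    sum_cells_eq_sum_rows, kappa]
  refine Finset.sum_congr rfl fun i _ => ?_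
  simp only [Finset.sum_const, card_range, nsmul_eq_mul]
  ring

theorem card_same_row (ν : YoungDiagram) (r : ℕ) :
    (univ.filter fun k => (filling ν k).1.1 = r).card = ν.rowLen r := by
  rw [YoungDiagram.rowLen_eq_card]
  refine Finset.card_nbij (fun k => (filling ν k).1) ?_ ?_ ?_
  · intro k hk
    have hk := (mem_filter.1 (Finset.mem_coe.1 hk))
    exact YoungDiagram.mem_row_iff.2 ⟨(filling ν k).2, hk.2⟩
  · intro k _ l _ h
    exact (filling ν).injective (Subtype.ext h)
  · intro c hc
    have hc := YoungDiagram.mem_row_iff.1 (Finset.mem_coe.1 hc)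
    exact ⟨(filling ν).symm ⟨c, hc.1⟩, by simp [hc.2], by simp⟩

theorem card_same_col (ν : YoungDiagram) (r : ℕ) :
    (univ.filter fun k => (filling ν k).1.2 = r).card = ν.colLen r := by
  rw [YoungDiagram.colLen_eq_card]
  refine Finset.card_nbij (fun k => (filling ν k).1) ?_ ?_ ?_
  · intro k hk
    have hk := (mem_filter.1 (Finset.mem_coe.1 hk))
    exact YoungDiagram.mem_col_iff.2 ⟨(filling ν k).2, hk.2⟩
  · intro k _ l _ h
    exact (filling ν).injective (Subtype.ext h)
  · intro c hc
    have hc := YoungDiagram.mem_col_iff.1 (Finset.mem_coe.1 hc)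
    exact ⟨(filling ν).symm ⟨c, hc.1⟩, by simp [hc.2], by simp⟩

theorem sum_pairs_eq_kappa (ν : YoungDiagram) :
    ∑ k : Fin ν.card, ∑ l : Fin ν.card,
      ((if (filling ν l).1.1 = (filling ν k).1.1 then (1 : ℤ) else 0) -
        if (filling ν l).1.2 = (filling ν k).1.2 then 1 else 0) = kappa ν := by
  simp only [Finset.sum_sub_distrib, Finset.sum_boole, card_same_row, card_same_col]
  rw [← Finset.sum_sub_distrib, ← sum_cells_rowLen_sub_colLen,
    ← Finset.sum_coe_sort ν.cells]
  exact Fintype.sum_equiv (filling ν) _ _ fun k => rfl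

/-! ### The action on the Young symmetrizer -/

/-- The sum of the permutations that preserve the rows. -/
def rowSum (ν : YoungDiagram) : MonoidAlgebra ℂ (Perm (Fin ν.card)) :=
  ∑ σ ∈ rowStabilizer ν, MonoidAlgebra.of ℂ _ σ

/-- The signed sum of the permutations that preserve the columns. -/
def colSum (ν : YoungDiagram) : MonoidAlgebra ℂ (Perm (Fin ν.card)) :=
  ∑ σ ∈ colStabilizer ν, ((Perm.sign σ : ℤ) : ℂ) • MonoidAlgebra.of ℂ _ σ

theorem rowSum_mul_of_swap {ν : YoungDiagram} {x y : Fin ν.card}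
    (h : (filling ν y).1.1 = (filling ν x).1.1) :
    rowSum ν * MonoidAlgebra.of ℂ _ (swap x y) = rowSum ν := by
  have hs : ∀ k, (filling ν (swap x y k)).1.1 = (filling ν k).1.1 := by
    intro k
    rw [swap_apply_def]
    split_ifs with h1 h2
    · rw [h1, h]
    · rw [h2, h]
    · rfl
  rw [rowSum, Finset.sum_mul]
  have hm : ∀ σ ∈ rowStabilizer ν, σ * swap x y ∈ rowStabilizer ν := by
    intro σ hσ
    simp only [rowStabilizer, mem_filter, mem_univ, true_and] at hσ ⊢
    intro k
    rw [Perm.mul_apply, hσ, hs]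
  refine Finset.sum_nbij' (· * swap x y) (· * swap x y) hm hm ?_ ?_ ?_
  · intro σ _; simp [mul_assoc]
  · intro σ _; simp [mul_assoc]
  · intro σ _; rw [← map_mul]

theorem of_swap_mul_colSum {ν : YoungDiagram} {x y : Fin ν.card} (hxy : x ≠ y)
    (h : (filling ν y).1.2 = (filling ν x).1.2) :
    MonoidAlgebra.of ℂ _ (swap x y) * colSum ν = -colSum ν := by
  have hs : ∀ k, (filling ν (swap x y k)).1.2 = (filling ν k).1.2 := by
    intro k
    rw [swap_apply_def]
    split_ifs with h1 h2
    · rw [h1, h]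
    · rw [h2, h]
    · rfl
  rw [colSum, Finset.mul_sum, ← Finset.sum_neg_distrib]
  have hm : ∀ σ ∈ colStabilizer ν, swap x y * σ ∈ colStabilizer ν := by
    intro σ hσ
    simp only [colStabilizer, mem_filter, mem_univ, true_and] at hσ ⊢
    intro k
    rw [Perm.mul_apply, hs, hσ]
  refine Finset.sum_nbij' (swap x y * ·) (swap x y * ·) hm hm ?_ ?_ ?_
  · intro σ _; simp [← mul_assoc]
  · intro σ _; simp [← mul_assoc]
  · intro σ _
    rw [mul_smul_comm, ← map_mul, Perm.sign_mul, Perm.sign_swap hxy]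
    simp

/-- If `x` and `y` lie in different rows and columns, let `m` be the box in the row of the upper
and the column of the other one.  The transposition `(x m)` preserves rows, and its conjugate
by `(x y)`, which is `(y m)`, is an odd permutation preserving columns. -/
theorem rowSum_mul_of_swap_mul_colSum_of_lt {ν : YoungDiagram} {x y : Fin ν.card}
    (hr : (filling ν x).1.1 < (filling ν y).1.1) (hc : (filling ν y).1.2 ≠ (filling ν x).1.2) :
    rowSum ν * MonoidAlgebra.of ℂ _ (swap x y) * colSum ν = 0 := by
  have hmem : ((filling ν x).1.1, (filling ν y).1.2) ∈ ν :=
    ν.up_left_mem hr.le le_rfl (filling ν y).2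
  obtain ⟨m, hm⟩ := (filling ν).surjective ⟨_, hmem⟩
  have hmr : (filling ν m).1.1 = (filling ν x).1.1 := by rw [hm]
  have hmc : (filling ν m).1.2 = (filling ν y).1.2 := by rw [hm]
  have hxm : x ≠ m := by rintro rfl; exact hc hmc.symm
  have hym : y ≠ m := by rintro rfl; exact hr.ne' hmr
  have hxy : x ≠ y := by rintro rfl; exact hr.ne rfl
  have hconj : swap x m * swap x y = swap x y * swap y m := by
    rw [mul_swap_eq_swap_mul (swap x y), swap_apply_right, swap_apply_of_ne_of_ne hxm.symm hym.symm]
  have h : rowSum ν * MonoidAlgebra.of ℂ _ (swap x y) * colSum ν =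
      -(rowSum ν * MonoidAlgebra.of ℂ _ (swap x y) * colSum ν) := by
    conv_lhs => rw [← rowSum_mul_of_swap hmr]
    rw [mul_assoc (rowSum ν), ← map_mul, hconj, map_mul, mul_assoc, mul_assoc,
      of_swap_mul_colSum hym hmc, mul_neg, mul_neg, mul_assoc]
  have h2 : (2 : ℂ) • (rowSum ν * MonoidAlgebra.of ℂ _ (swap x y) * colSum ν) = 0 := by
    rw [two_smul]
    exact eq_neg_iff_add_eq_zero.1 h
  exact (smul_eq_zero.1 h2).resolve_left two_ne_zero

theorem rowSum_mul_swap_mul_colSum (ν : YoungDiagram) (x y : Fin ν.card) :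
    rowSum ν * (if x = y then 0 else MonoidAlgebra.of ℂ _ (swap x y)) * colSum ν =
      ((if (filling ν y).1.1 = (filling ν x).1.1 then (1 : ℤ) else 0) -
        if (filling ν y).1.2 = (filling ν x).1.2 then 1 else 0) • (rowSum ν * colSum ν) := by
  by_cases hxy : x = y
  · simp [hxy]
  rw [if_neg hxy]
  by_cases hr : (filling ν y).1.1 = (filling ν x).1.1
  · have hc : (filling ν y).1.2 ≠ (filling ν x).1.2 := fun hc =>
      hxy ((filling ν).injective (Subtype.ext (Prod.ext hr.symm hc.symm)))
    rw [rowSum_mul_of_swap hr, if_pos hr, if_neg hc]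
    simp
  · by_cases hc : (filling ν y).1.2 = (filling ν x).1.2
    · rw [mul_assoc, of_swap_mul_colSum hxy hc, if_neg hr, if_pos hc]
      simp
    · rw [if_neg hr, if_neg hc, sub_self, zero_smul]
      rcases lt_or_gt_of_ne hr with h | h
      · rw [swap_comm]
        exact rowSum_mul_of_swap_mul_colSum_of_lt h (Ne.symm hc)
      · exact rowSum_mul_of_swap_mul_colSum_of_lt h hc

theorem transpositionSum_mul_youngSymmetrizer (ν : YoungDiagram) :
    transpositionSum (Fin ν.card) * youngSymmetrizer ν = (kappa ν : ℂ) • youngSymmetrizer ν := by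
  have hy : youngSymmetrizer ν = rowSum ν * colSum ν := rfl
  rw [hy, ← mul_assoc, (transpositionSum_commute (rowSum ν)).eq, transpositionSum, Finset.mul_sum,
    Finset.sum_mul]
  simp only [Finset.mul_sum, Finset.sum_mul, rowSum_mul_swap_mul_colSum, ← Finset.sum_smul]
  rw [sum_pairs_eq_kappa, Int.cast_smul_eq_zsmul]

theorem transpositionSum_mul_of_mem {ν : YoungDiagram}
    {z : MonoidAlgebra ℂ (Perm (Fin ν.card))} (hz : z ∈ Irrep ν) :
    transpositionSum (Fin ν.card) * z = (kappa ν : ℂ) • z := by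
  obtain ⟨r, rfl⟩ := Ideal.mem_span_singleton'.1 hz
  rw [← mul_assoc, (transpositionSum_commute r).eq, mul_assoc,
    transpositionSum_mul_youngSymmetrizer, mul_smul_comm]

/-! ### Consequences for the character -/

/-- The character of `R_ν`, extended linearly to the group algebra. -/
def linearCharacter (ν : YoungDiagram) : MonoidAlgebra ℂ (Perm (Fin ν.card)) →ₗ[ℂ] ℂ :=
  LinearMap.trace ℂ (Irrep ν) ∘ₗ (Algebra.lsmul ℂ ℂ (Irrep ν)).toLinearMap

theorem linearCharacter_mul_comm (ν : YoungDiagram) (a b : MonoidAlgebra ℂ (Perm (Fin ν.card))) :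
    linearCharacter ν (a * b) = linearCharacter ν (b * a) := by
  simp only [linearCharacter, LinearMap.comp_apply, AlgHom.toLinearMap_apply, map_mul]
  exact LinearMap.trace_mul_comm _ _ _

theorem irrepCharacter_eq_of_isConj {ν : YoungDiagram} {σ τ : Perm (Fin ν.card)}
    (h : IsConj σ τ) : irrepCharacter ν σ = irrepCharacter ν τ := by
  obtain ⟨g, rfl⟩ := isConj_iff.1 h
  change linearCharacter ν _ = linearCharacter ν _
  rw [map_mul, linearCharacter_mul_comm, ← map_mul, inv_mul_cancel_left]

theorem sum_irrepCharacter_swap_mul (ν : YoungDiagram) (σ : Perm (Fin ν.card)) :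
    ∑ x : Fin ν.card, ∑ y : Fin ν.card,
      (if x = y then 0 else irrepCharacter ν (swap x y * σ)) = kappa ν * irrepCharacter ν σ := by
  have h : linearCharacter ν (transpositionSum (Fin ν.card) * MonoidAlgebra.of ℂ _ σ) =
      kappa ν * irrepCharacter ν σ := by
    have h2 : Algebra.lsmul ℂ ℂ (Irrep ν)
        (transpositionSum (Fin ν.card) * MonoidAlgebra.of ℂ _ σ) =
        (kappa ν : ℂ) • Algebra.lsmul ℂ ℂ (Irrep ν) (MonoidAlgebra.of ℂ _ σ) := by
      ext1 z
      apply Subtype.ext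
      simp only [Algebra.lsmul_coe, LinearMap.smul_apply, mul_smul]
      exact transpositionSum_mul_of_mem ((MonoidAlgebra.of ℂ _ σ) • z).2
    simp only [linearCharacter, LinearMap.comp_apply, AlgHom.toLinearMap_apply]
    rw [h2, map_smul, smul_eq_mul]
    rfl
  rw [← h, transpositionSum, Finset.sum_mul, map_sum]
  refine Finset.sum_congr rfl fun x _ => ?_
  rw [Finset.sum_mul, map_sum]
  refine Finset.sum_congr rfl fun y _ => ?_
  split_ifs
  · simp
  · rw [← map_mul]; rfl

/-! ### Orbits of a permutation and multiplication by a transposition -/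

section Orbits

theorem iterate_mem_of_invariant {α : Type*} {τ : Perm α} {A : Finset α}
    (hA : ∀ z ∈ A, τ z ∈ A) {x : α}
    (hx : x ∈ A) (n : ℕ) : τ^[n] x ∈ A := by
  induction n with
  | zero => exact hx
  | succ n ih => rw [Function.iterate_succ_apply']; exact hA _ ih

theorem minimalPeriod_pos {α : Type*} [Finite α] (σ : Perm α) (x : α) :
    0 < Function.minimalPeriod σ x :=
  Function.minimalPeriod_pos_of_mem_periodicPts (σ.injective.mem_periodicPts x)

theorem card_image_iterate {α : Type*} [DecidableEq α] (σ : Perm α) (x : α) {s : Finset ℕ}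
    (hs : ∀ i ∈ s, i < Function.minimalPeriod σ x) :
    (s.image fun i => σ^[i] x).card = s.card :=
  Finset.card_image_of_injOn fun _ hi _ hj h =>
    Function.iterate_injOn_Iio_minimalPeriod (hs _ hi) (hs _ hj) h

variable {α : Type*} [Fintype α] [DecidableEq α]

/-- The cycle of `σ` through `x`, as a set; fixed points form cycles of length one. -/
def orbit (σ : Perm α) (x : α) : Finset α := univ.filter (σ.SameCycle x)

/-- The set of all cycles of `σ`, including the fixed points. -/
def orbits (σ : Perm α) : Finset (Finset α) := univ.image (orbit σ)

theorem mem_orbit {σ : Perm α} {x y : α} : y ∈ orbit σ x ↔ σ.SameCycle x y := by simp [orbit]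

theorem self_mem_orbit (σ : Perm α) (x : α) : x ∈ orbit σ x := mem_orbit.2 (Perm.SameCycle.refl _ _)

theorem orbit_mem_orbits (σ : Perm α) (x : α) : orbit σ x ∈ orbits σ :=
  mem_image_of_mem _ (mem_univ x)

theorem orbit_eq_orbit_iff {σ : Perm α} {x y : α} : orbit σ x = orbit σ y ↔ σ.SameCycle x y := by
  constructor
  · intro h
    exact mem_orbit.1 (h ▸ self_mem_orbit σ y)
  · intro h
    ext z
    rw [mem_orbit, mem_orbit]
    exact ⟨h.symm.trans, h.trans⟩

theorem apply_mem_orbit {σ : Perm α} {x y : α} : σ y ∈ orbit σ x ↔ y ∈ orbit σ x := by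
  rw [mem_orbit, mem_orbit, Perm.sameCycle_apply_right]

theorem eq_orbit_of_mem {σ : Perm α} {A : Finset α} (hA : A ∈ orbits σ) {x : α} (hx : x ∈ A) :
    A = orbit σ x := by
  obtain ⟨y, -, rfl⟩ := mem_image.1 hA
  exact orbit_eq_orbit_iff.2 (mem_orbit.1 hx)

theorem orbit_subset_of_invariant {τ : Perm α} {A : Finset α} (hA : ∀ z ∈ A, τ z ∈ A) {x : α}
    (hx : x ∈ A) : orbit τ x ⊆ A := by
  intro y hy
  obtain ⟨n, -, hn⟩ := (mem_orbit.1 hy).exists_pow_eq'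
  rw [← hn, ← Perm.iterate_eq_pow]
  exact iterate_mem_of_invariant hA hx n

/-- A cyclic sequence that `τ` traverses is an orbit of `τ`. -/
theorem orbit_eq_image {τ : Perm α} {c : ℕ → α} {n : ℕ}
    (hstep : ∀ i, i + 1 < n → τ (c i) = c (i + 1))
    (hlast : τ (c (n - 1)) = c 0) {z : α} (hz : z ∈ (range n).image c) :
    orbit τ z = (range n).image c := by
  have hinv : ∀ z ∈ (range n).image c, τ z ∈ (range n).image c := by
    intro z hz
    obtain ⟨i, hi, rfl⟩ := mem_image.1 hz
    rw [mem_range] at hi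
    rcases Nat.lt_or_ge (i + 1) n with h | h
    · rw [hstep i h]
      exact mem_image_of_mem _ (mem_range.2 h)
    · obtain rfl : i = n - 1 := by omega
      rw [hlast]
      exact mem_image_of_mem _ (mem_range.2 (by omega))
  have hsame : ∀ i < n, τ.SameCycle (c 0) (c i) := by
    intro i
    induction i with
    | zero => intro _; exact Perm.SameCycle.refl _ _
    | succ i ih =>
      intro h
      rw [← hstep i h, Perm.sameCycle_apply_right]
      exact ih (by omega)
  refine Finset.Subset.antisymm (orbit_subset_of_invariant hinv hz) fun y hy => ?_
  obtain ⟨i, hi, rfl⟩ := mem_image.1 hz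
  obtain ⟨j, hj, rfl⟩ := mem_image.1 hy
  exact mem_orbit.2 ((hsame i (mem_range.1 hi)).symm.trans (hsame j (mem_range.1 hj)))

theorem orbit_eq_image_iterate (σ : Perm α) (x : α) :
    orbit σ x = (range (Function.minimalPeriod σ x)).image fun i => σ^[i] x := by
  have hpos := minimalPeriod_pos σ x
  refine orbit_eq_image (c := fun i => σ^[i] x)
    (fun i _ => (Function.iterate_succ_apply' _ _ _).symm) ?_
    (mem_image.2 ⟨0, mem_range.2 hpos, rfl⟩)
  rw [← Function.iterate_succ_apply' σ, Nat.succ_eq_add_one, Nat.sub_add_cancel hpos]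
  exact Function.iterate_minimalPeriod

theorem card_orbit (σ : Perm α) (x : α) : (orbit σ x).card = Function.minimalPeriod σ x := by
  rw [orbit_eq_image_iterate, card_image_iterate _ _ fun i hi => mem_range.1 hi, card_range]

theorem card_pos_of_mem_orbits {σ : Perm α} {A : Finset α} (hA : A ∈ orbits σ) : 0 < A.card := by
  obtain ⟨x, -, rfl⟩ := mem_image.1 hA
  exact card_pos.2 ⟨x, self_mem_orbit σ x⟩

theorem sum_univ_eq_sum_orbits {M : Type*} [AddCommMonoid M] (σ : Perm α) (f : α → M) :
    ∑ x, f x = ∑ A ∈ orbits σ, ∑ x ∈ A, f x := by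
  rw [← Finset.sum_fiberwise_of_maps_to (fun x _ => orbit_mem_orbits σ x)]
  refine Finset.sum_congr rfl fun A hA => Finset.sum_congr ?_ fun _ _ => rfl
  ext x
  simp only [mem_filter, mem_univ, true_and]
  exact ⟨fun h => h ▸ self_mem_orbit σ x, fun h => (eq_orbit_of_mem hA h).symm⟩

/-- If `τ` agrees with `σ` outside a `σ`-invariant set `C`, their orbits outside `C` agree. -/
theorem orbit_eq_orbit_of_eqOn {σ τ : Perm α} {C : Finset α} (hC : ∀ z, σ z ∈ C ↔ z ∈ C)
    (h : ∀ z ∉ C, τ z = σ z) {z : α} (hz : z ∉ C) : orbit τ z = orbit σ z := by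
  have hpos := minimalPeriod_pos σ z
  have hout : ∀ n, σ^[n] z ∉ C := by
    intro n
    induction n with
    | zero => exact hz
    | succ n ih => rw [Function.iterate_succ_apply', hC]; exact ih
  rw [orbit_eq_image_iterate σ z]
  refine orbit_eq_image (fun i _ => ?_) ?_ (mem_image.2 ⟨0, mem_range.2 hpos, rfl⟩)
  · rw [h _ (hout i), Function.iterate_succ_apply']
  · rw [h _ (hout _), ← Function.iterate_succ_apply' σ, Nat.succ_eq_add_one,
      Nat.sub_add_cancel hpos]
    exact Function.iterate_minimalPeriod

/-- If `τ` agrees with `σ` outside a `σ`-invariant set `C` and `T` is the set of the orbits of `τ`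
in `C`, then the orbits of `τ` are those in `T` and the orbits of `σ` disjoint from `C`. -/
theorem prod_orbits_eq {M : Type*} [CommMonoid M] {σ τ : Perm α} {C : Finset α}
    (hC : ∀ z, σ z ∈ C ↔ z ∈ C) (h : ∀ z ∉ C, τ z = σ z) {T : Finset (Finset α)}
    (hT : ∀ z ∈ C, orbit τ z ∈ T) (hT' : ∀ A ∈ T, ∃ z ∈ C, orbit τ z = A) (f : Finset α → M) :
    ∏ A ∈ orbits τ, f A = (∏ A ∈ T, f A) * ∏ A ∈ (orbits σ).filter (Disjoint · C), f A := by
  have hdisj : ∀ {z}, z ∉ C → Disjoint (orbit σ z) C := by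
    intro z hz
    have : orbit σ z ⊆ Cᶜ :=
      orbit_subset_of_invariant (fun w hw => by rw [mem_compl] at hw ⊢; rwa [hC]) (mem_compl.2 hz)
    exact (disjoint_compl_right.mono_right this).symm
  rw [← Finset.prod_union]
  · refine Finset.prod_congr ?_ fun _ _ => rfl
    ext A
    simp only [mem_union, mem_filter]
    constructor
    · intro hA
      obtain ⟨z, -, rfl⟩ := mem_image.1 hA
      by_cases hz : z ∈ C
      · exact Or.inl (hT z hz)
      · rw [orbit_eq_orbit_of_eqOn hC h hz]
        exact Or.inr ⟨orbit_mem_orbits σ z, hdisj hz⟩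
    · rintro (hA | ⟨hA, hd⟩)
      · obtain ⟨z, -, rfl⟩ := hT' A hA
        exact orbit_mem_orbits τ z
      · obtain ⟨z, -, rfl⟩ := mem_image.1 hA
        have hz : z ∉ C := Finset.disjoint_left.1 hd (self_mem_orbit σ z)
        rw [← orbit_eq_orbit_of_eqOn hC h hz]
        exact orbit_mem_orbits τ z
  · rw [Finset.disjoint_left]
    intro A hA hA'
    obtain ⟨z, hz, rfl⟩ := hT' A hA
    exact Finset.disjoint_left.1 (mem_filter.1 hA').2 (self_mem_orbit τ z) hz

/-- Multiplication by `(x y)` cuts a cycle through `x` and `y`. -/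
theorem prod_orbits_swap_mul_of_sameCycle {M : Type*} [CommMonoid M] (σ : Perm α) (x : α) {k : ℕ}
    (hk : 0 < k) (hkn : k < (orbit σ x).card) (f : ℕ → M) :
    ∏ A ∈ orbits (swap x (σ^[k] x) * σ), f A.card =
      f k * f ((orbit σ x).card - k) * ∏ A ∈ (orbits σ).erase (orbit σ x), f A.card := by
  have hn := card_orbit σ x
  set n := (orbit σ x).card with hn_def
  have hper : σ^[n] x = x := by rw [hn]; exact Function.iterate_minimalPeriod
  have hinj : ∀ {i j}, i < n → j < n → σ^[i] x = σ^[j] x → i = j := by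
    intro i j hi hj hij
    rw [hn] at hi hj
    exact Function.iterate_injOn_Iio_minimalPeriod hi hj hij
  have himg := orbit_eq_image_iterate σ x
  rw [← hn] at himg
  set y := σ^[k] x with hy
  set τ := swap x y * σ with hτ
  have hτi : ∀ i, i + 1 < n → i + 1 ≠ k → τ (σ^[i] x) = σ^[i + 1] x := by
    intro i hi hik
    rw [hτ, Perm.mul_apply, ← Function.iterate_succ_apply' σ, swap_apply_of_ne_of_ne]
    · intro h
      exact absurd (hinj hi (by omega) (h.trans (Function.iterate_zero_apply _ _).symm)) (by omega)
    · intro h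
      exact hik (hinj hi hkn h)
  have hτk : τ (σ^[k - 1] x) = x := by
    rw [hτ, Perm.mul_apply, ← Function.iterate_succ_apply' σ, Nat.succ_eq_add_one,
      Nat.sub_add_cancel hk, ← hy, swap_apply_right]
  have hτn : τ (σ^[n - 1] x) = y := by
    rw [hτ, Perm.mul_apply, ← Function.iterate_succ_apply' σ, Nat.succ_eq_add_one,
      Nat.sub_add_cancel (by omega), hper, swap_apply_left]
  -- The two new cycles start at `x` and at `y = σ^k x`.
  set A₁ := (range k).image fun i => σ^[i] x with hA₁
  set A₂ := (range (n - k)).image fun i => σ^[k + i] x with hA₂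
  have h1 : ∀ z ∈ A₁, orbit τ z = A₁ := fun z hz =>
    orbit_eq_image (fun i hi => hτi i (by omega) (by omega)) hτk hz
  have h2 : ∀ z ∈ A₂, orbit τ z = A₂ := fun z hz =>
    orbit_eq_image (fun i hi => hτi (k + i) (by omega) (by omega))
      (by rw [show k + (n - k - 1) = n - 1 by omega, hτn]; rfl) hz
  have hx : x ∈ A₁ := mem_image.2 ⟨0, mem_range.2 hk, rfl⟩
  have hy2 : y ∈ A₂ := mem_image.2 ⟨0, mem_range.2 (by omega), rfl⟩
  have hA₂' : A₂ = (Ico k n).image fun i => σ^[i] x := by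
    rw [hA₂, Finset.range_eq_Ico]
    ext z
    simp only [mem_image, mem_Ico]
    constructor
    · rintro ⟨i, hi, rfl⟩
      exact ⟨k + i, by omega, rfl⟩
    · rintro ⟨i, hi, rfl⟩
      exact ⟨i - k, by omega, by rw [Nat.add_sub_cancel' hi.1]⟩
  have hc1 : A₁.card = k := by
    rw [hA₁, card_image_iterate _ _ fun i hi => ?_, card_range]
    rw [mem_range] at hi
    omega
  have hc2 : A₂.card = n - k := by
    rw [hA₂', card_image_iterate _ _ fun i hi => ?_, Nat.card_Ico]
    rw [mem_Ico] at hi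
    omega
  have hne : A₁ ≠ A₂ := by
    intro h
    rw [h, hA₂'] at hx
    obtain ⟨i, hi, hix⟩ := mem_image.1 hx
    rw [mem_Ico] at hi
    exact absurd (hinj hi.2 (by omega) (hix.trans (Function.iterate_zero_apply σ _).symm))
      (by omega)
  have hunion : ∀ z ∈ orbit σ x, z ∈ A₁ ∨ z ∈ A₂ := by
    intro z hz
    rw [himg] at hz
    obtain ⟨i, hi, rfl⟩ := mem_image.1 hz
    rw [mem_range] at hi
    rcases Nat.lt_or_ge i k with h | h
    · exact Or.inl (mem_image_of_mem _ (mem_range.2 h))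
    · rw [hA₂']
      exact Or.inr (mem_image_of_mem _ (mem_Ico.2 ⟨h, hi⟩))
  have hyo : y ∈ orbit σ x := by
    rw [himg]
    exact mem_image_of_mem _ (mem_range.2 hkn)
  rw [prod_orbits_eq (σ := σ) (C := orbit σ x) (T := {A₁, A₂}) (fun z => apply_mem_orbit),
    Finset.prod_pair hne, hc1, hc2]
  · congr 1
    refine Finset.prod_congr ?_ fun _ _ => rfl
    ext A
    simp only [mem_filter, mem_erase]
    constructor
    · rintro ⟨hA, hd⟩
      refine ⟨?_, hA⟩
      rintro rfl
      exact Finset.disjoint_left.1 hd (self_mem_orbit σ x) (self_mem_orbit σ x)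
    · rintro ⟨hA, hA'⟩
      refine ⟨hA', Finset.disjoint_left.2 fun z hz hz' => hA ?_⟩
      rw [eq_orbit_of_mem hA' hz]
      exact orbit_eq_orbit_iff.2 (mem_orbit.1 hz').symm
  · intro z hz
    rw [hτ, Perm.mul_apply, swap_apply_of_ne_of_ne]
    · intro h
      exact hz (apply_mem_orbit.1 (h ▸ self_mem_orbit σ x))
    · intro h
      exact hz (apply_mem_orbit.1 (h ▸ hyo))
  · intro z hz
    rcases hunion z hz with h | h
    · rw [h1 z h]; simp
    · rw [h2 z h]; simp
  · intro A hA
    rcases mem_insert.1 hA with rfl | hA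
    · exact ⟨x, self_mem_orbit σ x, h1 x hx⟩
    · rw [mem_singleton.1 hA]
      exact ⟨y, hyo, h2 y hy2⟩

/-- Multiplication by `(x y)` joins the cycles through `x` and through `y` if they differ. -/
theorem prod_orbits_swap_mul_of_not_sameCycle {M : Type*} [CommMonoid M] (σ : Perm α) {x y : α}
    (hxy : orbit σ y ≠ orbit σ x) (f : ℕ → M) :
    ∏ A ∈ orbits (swap x y * σ), f A.card =
      f ((orbit σ x).card + (orbit σ y).card) *
        ∏ A ∈ ((orbits σ).erase (orbit σ x)).erase (orbit σ y), f A.card := by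
  have hm := card_orbit σ x
  have hn := card_orbit σ y
  set m := (orbit σ x).card with hm_def
  set n := (orbit σ y).card with hn_def
  have hm0 : 0 < m := hm ▸ minimalPeriod_pos σ x
  have hn0 : 0 < n := hn ▸ minimalPeriod_pos σ y
  have himx := orbit_eq_image_iterate σ x
  have himy := orbit_eq_image_iterate σ y
  rw [← hm] at himx
  rw [← hn] at himy
  have hmemx : ∀ i, σ^[i] x ∈ orbit σ x := fun i =>
    iterate_mem_of_invariant (fun z hz => apply_mem_orbit.2 hz) (self_mem_orbit σ x) i
  have hmemy : ∀ i, σ^[i] y ∈ orbit σ y := fun i =>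
    iterate_mem_of_invariant (fun z hz => apply_mem_orbit.2 hz) (self_mem_orbit σ y) i
  have hdisj : Disjoint (orbit σ x) (orbit σ y) := by
    refine Finset.disjoint_left.2 fun z hz hz' => hxy ?_
    exact orbit_eq_orbit_iff.2 ((mem_orbit.1 hz').trans (mem_orbit.1 hz).symm)
  set τ := swap x y * σ with hτ
  have hτx : ∀ i, i + 1 < m → τ (σ^[i] x) = σ^[i + 1] x := by
    intro i hi
    rw [hτ, Perm.mul_apply, ← Function.iterate_succ_apply' σ, swap_apply_of_ne_of_ne]
    · intro h
      rw [hm] at hi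
      exact absurd (Function.iterate_injOn_Iio_minimalPeriod hi (minimalPeriod_pos σ x)
        (h.trans (Function.iterate_zero_apply σ _).symm)) (Nat.succ_ne_zero i)
    · intro h
      exact Finset.disjoint_left.1 hdisj (h ▸ hmemx (i + 1)) (self_mem_orbit σ y)
  have hτy : ∀ i, i + 1 < n → τ (σ^[i] y) = σ^[i + 1] y := by
    intro i hi
    rw [hτ, Perm.mul_apply, ← Function.iterate_succ_apply' σ, swap_apply_of_ne_of_ne]
    · intro h
      exact Finset.disjoint_left.1 hdisj (self_mem_orbit σ x) (h ▸ hmemy (i + 1))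
    · intro h
      rw [hn] at hi
      exact absurd (Function.iterate_injOn_Iio_minimalPeriod hi (minimalPeriod_pos σ y)
        (h.trans (Function.iterate_zero_apply σ _).symm)) (Nat.succ_ne_zero i)
  have hτm : τ (σ^[m - 1] x) = y := by
    rw [hτ, Perm.mul_apply, ← Function.iterate_succ_apply' σ, Nat.succ_eq_add_one,
      Nat.sub_add_cancel hm0, hm, Function.iterate_minimalPeriod, swap_apply_left]
  have hτn : τ (σ^[n - 1] y) = x := by
    rw [hτ, Perm.mul_apply, ← Function.iterate_succ_apply' σ, Nat.succ_eq_add_one,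
      Nat.sub_add_cancel hn0, hn, Function.iterate_minimalPeriod, swap_apply_right]
  -- The new cycle runs through the cycle of `x`, then through that of `y`.
  set c : ℕ → α := fun i => if i < m then σ^[i] x else σ^[i - m] y with hc
  have hcimg : (range (m + n)).image c = orbit σ x ∪ orbit σ y := by
    rw [himx, himy]
    ext z
    simp only [mem_union, mem_image, mem_range, hc]
    constructor
    · rintro ⟨i, hi, rfl⟩
      split_ifs with h
      · exact Or.inl ⟨i, h, rfl⟩
      · exact Or.inr ⟨i - m, by omega, rfl⟩
    · rintro (⟨i, hi, rfl⟩ | ⟨i, hi, rfl⟩)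
      · exact ⟨i, by omega, by rw [if_pos hi]⟩
      · exact ⟨m + i, by omega, by rw [if_neg (by omega), Nat.add_sub_cancel_left]⟩
  have hstep : ∀ i, i + 1 < m + n → τ (c i) = c (i + 1) := by
    intro i hi
    simp only [hc]
    rcases lt_trichotomy (i + 1) m with h | h | h
    · rw [if_pos (by omega), if_pos h, hτx i h]
    · rw [if_pos (by omega), if_neg (by omega), show i = m - 1 by omega, hτm]
      simp [Nat.sub_add_cancel hm0]
    · rw [if_neg (by omega), if_neg (by omega), hτy _ (by omega),
        show i - m + 1 = i + 1 - m by omega]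
  have hlast : τ (c (m + n - 1)) = c 0 := by
    simp only [hc]
    rw [if_neg (by omega), if_pos hm0, show m + n - 1 - m = n - 1 by omega, hτn]
    rfl
  have horb : ∀ z ∈ orbit σ x ∪ orbit σ y, orbit τ z = orbit σ x ∪ orbit σ y := by
    intro z hz
    rw [← hcimg] at hz ⊢
    exact orbit_eq_image hstep hlast hz
  rw [prod_orbits_eq (σ := σ) (C := orbit σ x ∪ orbit σ y) (T := {orbit σ x ∪ orbit σ y}),
    Finset.prod_singleton, Finset.card_union_of_disjoint hdisj]
  · congr 1
    refine Finset.prod_congr ?_ fun _ _ => rfl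
    ext A
    simp only [mem_filter, mem_erase, Finset.disjoint_union_right]
    constructor
    · rintro ⟨hA, hd, hd'⟩
      refine ⟨?_, ?_, hA⟩
      · rintro rfl
        exact Finset.disjoint_left.1 hd' (self_mem_orbit σ y) (self_mem_orbit σ y)
      · rintro rfl
        exact Finset.disjoint_left.1 hd (self_mem_orbit σ x) (self_mem_orbit σ x)
    · rintro ⟨hA, hA', hA''⟩
      refine ⟨hA'', Finset.disjoint_left.2 fun z hz hz' => hA' ?_,
        Finset.disjoint_left.2 fun z hz hz' => hA ?_⟩ <;>
      · rw [eq_orbit_of_mem hA'' hz]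
        exact orbit_eq_orbit_iff.2 (mem_orbit.1 hz').symm
  · intro z
    simp only [mem_union, apply_mem_orbit]
  · intro z hz
    rw [mem_union, not_or] at hz
    rw [hτ, Perm.mul_apply, swap_apply_of_ne_of_ne]
    · intro h
      exact hz.1 (apply_mem_orbit.1 (h ▸ self_mem_orbit σ x))
    · intro h
      exact hz.2 (apply_mem_orbit.1 (h ▸ self_mem_orbit σ y))
  · intro z hz
    rw [horb z hz]
    exact mem_singleton_self _
  · intro A hA
    rw [mem_singleton.1 hA]
    exact ⟨x, mem_union_left _ (self_mem_orbit σ x),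
      horb x (mem_union_left _ (self_mem_orbit σ x))⟩

/-- The sum of a cycle statistic over all products `(x y) σ` with `x ≠ y`, grouped by the cycles
that are cut or joined. -/
theorem sum_prod_orbits_swap_mul {M : Type*} [CommSemiring M] (σ : Perm α) (f : ℕ → M) :
    ∑ x, ∑ y, (if x = y then 0 else ∏ A ∈ orbits (swap x y * σ), f A.card) =
      (∑ A ∈ orbits σ, ∑ k ∈ Ico 1 A.card,
        A.card * (f k * f (A.card - k) * ∏ D ∈ (orbits σ).erase A, f D.card)) +
      ∑ A ∈ orbits σ, ∑ B ∈ (orbits σ).erase A,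
        (A.card : M) * B.card *
          (f (A.card + B.card) * ∏ D ∈ ((orbits σ).erase A).erase B, f D.card) := by
  rw [sum_univ_eq_sum_orbits σ, ← Finset.sum_add_distrib]
  refine Finset.sum_congr rfl fun A hA => ?_
  rw [← Finset.mul_sum]
  simp only [mul_assoc (A.card : M)]
  rw [← Finset.mul_sum, ← mul_add, ← nsmul_eq_mul]
  refine Finset.sum_eq_card_nsmul fun x hx => ?_
  obtain rfl := eq_orbit_of_mem hA hx
  rw [sum_univ_eq_sum_orbits σ, ← Finset.add_sum_erase _ _ hA]
  congr 1
  · rw [orbit_eq_image_iterate, Finset.sum_image, ← orbit_eq_image_iterate, ← card_orbit,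
      Finset.range_eq_Ico, Finset.sum_eq_sum_Ico_succ_bot (card_pos_of_mem_orbits hA)]
    · rw [if_pos (Function.iterate_zero_apply σ x).symm, zero_add]
      refine Finset.sum_congr rfl fun k hk => ?_
      rw [mem_Ico] at hk
      rw [if_neg, prod_orbits_swap_mul_of_sameCycle σ x (by omega) hk.2]
      intro h
      have hk2 := hk.2
      rw [card_orbit] at hk2
      have := Function.iterate_injOn_Iio_minimalPeriod (minimalPeriod_pos σ x) hk2
        ((Function.iterate_zero_apply σ x).trans h)
      omega
    · intro i hi j hj h
      exact Function.iterate_injOn_Iio_minimalPeriod (mem_range.1 (Finset.mem_coe.1 hi))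
        (mem_range.1 (Finset.mem_coe.1 hj)) h
  · refine Finset.sum_congr rfl fun B hB => ?_
    obtain ⟨hne, hB⟩ := mem_erase.1 hB
    rw [← nsmul_eq_mul]
    refine Finset.sum_eq_card_nsmul fun y hy => ?_
    obtain rfl := eq_orbit_of_mem hB hy
    rw [if_neg, prod_orbits_swap_mul_of_not_sameCycle σ hne]
    rintro rfl
    exact hne rfl

end Orbits

/-! ### Formal sums and the cut and join operators -/

section FormalSum

variable {ι : Type}

theorem coeff_formalSum (f : ι → Series) (m : Var →₀ ℕ) :
    MvPowerSeries.coeff m (formalSum f) = ∑ᶠ i, MvPowerSeries.coeff m (f i) := rfl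

theorem formalSum_eq_sum {f : ι → Series} {s : Finset ι} (h : ∀ i ∉ s, f i = 0) :
    formalSum f = ∑ i ∈ s, f i := by
  ext m
  rw [coeff_formalSum, map_sum]
  refine finsum_eq_sum_of_support_subset _ fun i hi => ?_
  by_contra his
  exact hi (by simp only [h i his, map_zero])

theorem formalSum_sum {κ : Type*} (s : Finset κ) {f : κ → ι → Series}
    (h : ∀ a ∈ s, LocallyFinite (f a)) :
    (formalSum fun i => ∑ a ∈ s, f a i) = ∑ a ∈ s, formalSum (f a) := by
  ext m
  simp only [coeff_formalSum, map_sum]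
  exact finsum_sum_comm s _ fun a ha => h a ha m

theorem formalSum_smul (c : ℂ) (f : ι → Series) :
    (formalSum fun i => c • f i) = c • formalSum f := by
  ext m
  simp only [coeff_formalSum, MvPowerSeries.coeff_smul, ← smul_eq_mul]
  exact (smul_finsum c _).symm

theorem locallyFinite_of_finset {f : ι → Series} (s : Finset ι) (h : ∀ i ∉ s, f i = 0) :
    LocallyFinite f := by
  intro m
  refine s.finite_toSet.subset fun i hi => ?_
  by_contra his
  exact hi (by simp only [h i his, map_zero])

end FormalSum

/-- The sum `C + J` of the cut and the join operator. -/
def cutJoin (v : ℕ+ → Var) (f : Series) : Series := cut v f + join v f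

section Linear

variable {v : ℕ+ → Var}

theorem cutJoin_smul (c : ℂ) (f : Series) : cutJoin v (c • f) = c • cutJoin v f := by
  have h1 : cutTerm v (c • f) = fun ij => c • cutTerm v f ij := by
    funext ij
    simp only [cutTerm, Derivation.map_smul, mul_smul_comm]
    rw [smul_comm]
  have h2 : joinTerm v (c • f) = fun ij => c • joinTerm v f ij := by
    funext ij
    simp only [joinTerm, Derivation.map_smul, mul_smul_comm]
    rw [smul_comm]
  rw [cutJoin, cut, join, h1, h2, formalSum_smul, formalSum_smul, ← smul_add]
  rfl

theorem cutJoin_sum (hv : Function.Injective v) {κ : Type*} (s : Finset κ) (f : κ → Series) :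
    cutJoin v (∑ a ∈ s, f a) = ∑ a ∈ s, cutJoin v (f a) := by
  have h1 : cutTerm v (∑ a ∈ s, f a) = fun ij => ∑ a ∈ s, cutTerm v (f a) ij := by
    funext ij
    simp only [cutTerm, map_sum, Finset.mul_sum, Finset.smul_sum]
  have h2 : joinTerm v (∑ a ∈ s, f a) = fun ij => ∑ a ∈ s, joinTerm v (f a) ij := by
    funext ij
    simp only [joinTerm, map_sum, Finset.mul_sum, Finset.smul_sum]
  rw [cutJoin, cut, join, h1, h2, formalSum_sum _ fun a _ => locallyFinite_cut hv (f a),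
    formalSum_sum _ fun a _ => locallyFinite_join hv (f a), ← Finset.sum_add_distrib]
  rfl

end Linear

/-! ### Locality of the operators in the degree -/

/-- The coefficients of `f` of degree less than `N` vanish. -/
def VanishesBelow (N : ℕ) (f : Series) : Prop :=
  ∀ m, degree m < N → MvPowerSeries.coeff m f = 0

theorem degree_single (x : Var) :
    degree (Finsupp.single x 1) = Sum.elim PNat.val PNat.val x := by
  simp [degree, Finsupp.sum_single_index]

theorem VanishesBelow.smul {N : ℕ} {f : Series} (h : VanishesBelow N f) (c : ℂ) :
    VanishesBelow N (c • f) := by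
  intro m hm
  rw [MvPowerSeries.coeff_smul, h m hm, mul_zero]

theorem VanishesBelow.mono {N N' : ℕ} {f : Series} (h : VanishesBelow N f) (hN : N' ≤ N) :
    VanishesBelow N' f := fun m hm => h m (hm.trans_le hN)

theorem VanishesBelow.X_mul {N : ℕ} {f : Series} (h : VanishesBelow N f) (x : Var) :
    VanishesBelow (N + Sum.elim PNat.val PNat.val x) (MvPowerSeries.X x * f) := by
  classical
  intro m hm
  rw [MvPowerSeries.X, MvPowerSeries.coeff_monomial_mul]
  split_ifs with hle
  · obtain ⟨m', rfl⟩ := exists_add_of_le hle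
    rw [degree_add, degree_single] at hm
    rw [add_tsub_cancel_left, h m' (by omega), mul_zero]
  · rfl

theorem VanishesBelow.pderiv {N : ℕ} {f : Series} (h : VanishesBelow N f) (x : Var) :
    VanishesBelow (N - Sum.elim PNat.val PNat.val x) (MvPowerSeries.pderiv ℂ x f) := by
  intro m hm
  rw [MvPowerSeries.coeff_pderiv, h, zero_mul]
  rw [degree_add, degree_single]
  omega

theorem VanishesBelow.formalSum {ι : Type} {N : ℕ} {f : ι → Series}
    (h : ∀ i, VanishesBelow N (f i)) : VanishesBelow N (formalSum f) := by
  intro m hm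
  rw [coeff_formalSum, finsum_eq_zero_of_forall_eq_zero fun i => h i m hm]

theorem VanishesBelow.cutJoin {v : ℕ+ → Var}
    (hv : ∀ n, Sum.elim PNat.val PNat.val (v n) = (n : ℕ)) {N : ℕ} {f : Series}
    (h : VanishesBelow N f) : VanishesBelow N (cutJoin v f) := by
  have h1 : VanishesBelow N (cut v f) := by
    refine VanishesBelow.formalSum fun ij => VanishesBelow.smul ?_ _
    rw [mul_assoc]
    refine (((h.pderiv (v (ij.1 + ij.2))).X_mul (v ij.2)).X_mul (v ij.1)).mono ?_
    rw [hv, hv, hv, PNat.add_coe]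
    omega
  have h2 : VanishesBelow N (join v f) := by
    refine VanishesBelow.formalSum fun ij => VanishesBelow.smul ?_ _
    refine (((h.pderiv (v ij.2)).pderiv (v ij.1)).X_mul (v (ij.1 + ij.2))).mono ?_
    rw [hv, hv, hv, PNat.add_coe]
    omega
  intro m hm
  rw [TwoPartition.cutJoin, map_add, h1 m hm, h2 m hm, add_zero]

/-! ### The operators on the monomial of a permutation -/

/-- The variable `p_n` selected by `v`, for a natural number `n` that is positive in all uses. -/
def pVar (v : ℕ+ → Var) (n : ℕ) : Series := MvPowerSeries.X (v n.toPNat')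

/-- The monomial `p_μ` for the cycle type `μ` of a permutation. -/
def permMonomial (v : ℕ+ → Var) {α : Type*} [Fintype α] [DecidableEq α] (σ : Perm α) : Series :=
  ∏ A ∈ orbits σ, pVar v A.card

section Monomial

variable {v : ℕ+ → Var} {α : Type*} [DecidableEq α]

theorem pderiv_pVar (hv : Function.Injective v) (n : ℕ+) {k : ℕ} (hk : 0 < k) :
    MvPowerSeries.pderiv ℂ (v n) (pVar v k) = if k = n then 1 else 0 := by
  classical
  rw [pVar]
  split_ifs with h
  · subst h
    rw [PNat.coe_toPNat', MvPowerSeries.pderiv_X_self]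
  · refine MvPowerSeries.pderiv_X_of_ne fun h' => h ?_
    rw [← hv h', PNat.toPNat'_coe hk]

theorem pderiv_prod_mul (hv : Function.Injective v) (n : ℕ+) {s : Finset (Finset α)}
    (hs : ∀ A ∈ s, 0 < A.card) {g : Series} (hg : MvPowerSeries.pderiv ℂ (v n) g = 0) :
    MvPowerSeries.pderiv ℂ (v n) ((∏ A ∈ s, pVar v A.card) * g) =
      ∑ A ∈ s, if A.card = n then (∏ D ∈ s.erase A, pVar v D.card) * g else 0 := by
  induction s using Finset.induction_on with
  | empty => simp [hg]
  | insert B s hB ih =>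
    have ih := ih fun A hA => hs A (mem_insert_of_mem hA)
    rw [Finset.prod_insert hB, mul_assoc, Derivation.leibniz, ih,
      pderiv_pVar hv n (hs B (mem_insert_self B s)), Finset.sum_insert hB,
      Finset.erase_insert hB, add_comm]
    congr 1
    · split_ifs <;> simp
    · rw [smul_eq_mul, Finset.mul_sum]
      refine Finset.sum_congr rfl fun A hA => ?_
      have hAB : B ≠ A := by rintro rfl; exact hB hA
      rw [mul_ite, mul_zero, Finset.erase_insert_of_ne hAB, Finset.prod_insert, mul_assoc]
      exact fun h => hB (mem_of_mem_erase h)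

/-- The factor `g`, which the derivations kill, stands for the part of the series in the other set
of variables. -/
theorem cut_prod_mul (hv : Function.Injective v) {s : Finset (Finset α)}
    (hs : ∀ A ∈ s, 0 < A.card) {g : Series} (hg : ∀ n, MvPowerSeries.pderiv ℂ (v n) g = 0) :
    cut v ((∏ A ∈ s, pVar v A.card) * g) =
      (∑ A ∈ s, ∑ k ∈ Ico 1 A.card, (A.card : Series) *
        (pVar v k * pVar v (A.card - k) * ∏ D ∈ s.erase A, pVar v D.card)) * g := by
  -- The pairs `(i, j)` with `i + j = n`.
  let T : ℕ → Finset (ℕ+ × ℕ+) := fun n =>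
    (Ico 1 n).image fun k => (k.toPNat', (n - k).toPNat')
  have hT : ∀ n, ∀ ij ∉ T n, n ≠ ((ij.1 + ij.2 : ℕ+) : ℕ) := by
    rintro n ⟨i, j⟩ hij rfl
    refine hij (mem_image.2 ⟨i, mem_Ico.2 ⟨i.2, ?_⟩, ?_⟩)
    · have := j.pos
      change (i : ℕ) < ((i + j : ℕ+) : ℕ)
      rw [PNat.add_coe]
      omega
    · simp only [PNat.add_coe, Nat.add_sub_cancel_left, PNat.coe_toPNat']
  let F : Finset α → ℕ+ × ℕ+ → Series := fun A ij =>
    if A.card = ((ij.1 + ij.2 : ℕ+) : ℕ) then (((ij.1 + ij.2 : ℕ+) : ℕ) : ℂ) •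
      (MvPowerSeries.X (v ij.1) * MvPowerSeries.X (v ij.2) *
        ((∏ D ∈ s.erase A, pVar v D.card) * g)) else 0
  have hF : ∀ A, ∀ ij ∉ T A.card, F A ij = 0 := fun A ij hij => if_neg (hT _ ij hij)
  have hcut : cutTerm v ((∏ A ∈ s, pVar v A.card) * g) = fun ij => ∑ A ∈ s, F A ij := by
    funext ij
    simp only [cutTerm, F]
    rw [pderiv_prod_mul hv _ hs (hg _), Finset.mul_sum, Finset.smul_sum]
    refine Finset.sum_congr rfl fun A _ => ?_
    rw [mul_ite, mul_zero, smul_ite, smul_zero]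
  rw [cut, hcut, formalSum_sum s fun A _ => locallyFinite_of_finset _ (hF A), Finset.sum_mul]
  refine Finset.sum_congr rfl fun A _ => ?_
  rw [formalSum_eq_sum (hF A), Finset.sum_image, Finset.sum_mul]
  · refine Finset.sum_congr rfl fun k hk => ?_
    rw [mem_Ico] at hk
    have h : ((k.toPNat' + (A.card - k).toPNat' : ℕ+) : ℕ) = A.card := by
      rw [PNat.add_coe, PNat.toPNat'_coe (by omega), PNat.toPNat'_coe (by omega)]
      omega
    simp only [F, h, if_true, pVar]
    rw [Nat.cast_smul_eq_nsmul, nsmul_eq_mul]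
    ring
  · intro k hk l hl h
    rw [Finset.mem_coe, mem_Ico] at hk hl
    have := congrArg PNat.val (congrArg Prod.fst h)
    rw [← PNat.toPNat'_coe (n := k) (by omega), ← PNat.toPNat'_coe (n := l) (by omega)]
    exact this

theorem join_prod_mul (hv : Function.Injective v) {s : Finset (Finset α)}
    (hs : ∀ A ∈ s, 0 < A.card) {g : Series} (hg : ∀ n, MvPowerSeries.pderiv ℂ (v n) g = 0) :
    join v ((∏ A ∈ s, pVar v A.card) * g) =
      (∑ A ∈ s, ∑ B ∈ s.erase A, (A.card : Series) * B.card *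
        (pVar v (A.card + B.card) * ∏ D ∈ (s.erase A).erase B, pVar v D.card)) * g := by
  let F : Finset α → Finset α → ℕ+ × ℕ+ → Series := fun A B ij =>
    if A.card = ij.2 then (if B.card = ij.1 then (((ij.1 : ℕ) : ℂ) * ((ij.2 : ℕ) : ℂ)) •
      (MvPowerSeries.X (v (ij.1 + ij.2)) *
        ((∏ D ∈ (s.erase A).erase B, pVar v D.card) * g)) else 0) else 0
  have hF : ∀ A B, ∀ ij ∉ ({(B.card.toPNat', A.card.toPNat')} : Finset (ℕ+ × ℕ+)),
      F A B ij = 0 := by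
    rintro A B ⟨i, j⟩ hij
    simp only [F]
    by_contra h
    refine hij (mem_singleton.2 ?_)
    split_ifs at h with h1 h2
    · rw [h1, h2, PNat.coe_toPNat', PNat.coe_toPNat']
    · exact absurd rfl h
    · exact absurd rfl h
  have hjoin : joinTerm v ((∏ A ∈ s, pVar v A.card) * g) =
      fun ij => ∑ A ∈ s, ∑ B ∈ s.erase A, F A B ij := by
    funext ij
    simp only [joinTerm, F]
    rw [pderiv_prod_mul hv _ hs (hg _), map_sum, Finset.mul_sum, Finset.smul_sum]
    refine Finset.sum_congr rfl fun A _ => ?_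
    split_ifs with h
    · rw [pderiv_prod_mul hv _ (fun B hB => hs B (mem_of_mem_erase hB)) (hg _), Finset.mul_sum,
        Finset.smul_sum]
      refine Finset.sum_congr rfl fun B _ => ?_
      rw [mul_ite, mul_zero, smul_ite, smul_zero]
    · simp
  have hfin : ∀ A B, LocallyFinite (F A B) := fun A B => locallyFinite_of_finset _ (hF A B)
  have hfin' : ∀ A, LocallyFinite fun ij => ∑ B ∈ s.erase A, F A B ij := fun A =>
    locallyFinite_of_finset ((s.erase A).biUnion fun B => {(B.card.toPNat', A.card.toPNat')})
      fun ij hij => Finset.sum_eq_zero fun B hB => hF A B ij fun h =>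
        hij (mem_biUnion.2 ⟨B, hB, h⟩)
  rw [join, hjoin, formalSum_sum s fun A _ => hfin' A, Finset.sum_mul]
  refine Finset.sum_congr rfl fun A hA => ?_
  rw [formalSum_sum _ fun B _ => hfin A B, Finset.sum_mul]
  refine Finset.sum_congr rfl fun B hB => ?_
  have hA0 := hs A hA
  have hB0 := hs B (mem_of_mem_erase hB)
  have h : B.card.toPNat' + A.card.toPNat' = (A.card + B.card).toPNat' := by
    apply PNat.eq
    rw [PNat.add_coe, PNat.toPNat'_coe hA0, PNat.toPNat'_coe hB0, PNat.toPNat'_coe (by omega),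
      add_comm]
  rw [formalSum_eq_sum (hF A B), Finset.sum_singleton]
  simp only [F, PNat.toPNat'_coe hA0, PNat.toPNat'_coe hB0, if_true, h, pVar]
  rw [← Nat.cast_mul, Nat.cast_smul_eq_nsmul, nsmul_eq_mul, Nat.cast_mul]
  ring

end Monomial

theorem cutJoin_permMonomial_mul {v : ℕ+ → Var} (hv : Function.Injective v) {α : Type*} [Fintype α]
    [DecidableEq α] (σ : Perm α) {g : Series} (hg : ∀ n, MvPowerSeries.pderiv ℂ (v n) g = 0) :
    cutJoin v (permMonomial v σ * g) =
      ∑ x, ∑ y, if x = y then 0 else permMonomial v (swap x y * σ) * g := by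
  have hs : ∀ A ∈ orbits σ, 0 < A.card := fun A hA => card_pos_of_mem_orbits hA
  rw [cutJoin, permMonomial, cut_prod_mul hv hs hg, join_prod_mul hv hs hg, ← add_mul,
    ← sum_prod_orbits_swap_mul]
  simp only [Finset.sum_mul, ite_mul, zero_mul, permMonomial]

/-! ### Eigenvectors of the cut-and-join operator -/

/-- The Schur function `s_ν = ∑_μ χ_ν(μ) p_μ / z_μ`, as an average over the symmetric group. -/
def schur (v : ℕ+ → Var) (ν : YoungDiagram) : Series :=
  ∑ σ : Perm (Fin ν.card), (irrepCharacter ν σ / ν.card.factorial) • permMonomial v σ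

/-- Reindexing by `σ ↦ (x y) σ` moves the operator from the power sums to the character. -/
theorem cutJoin_schur_mul {v : ℕ+ → Var} (hv : Function.Injective v) (ν : YoungDiagram)
    {g : Series} (hg : ∀ n, MvPowerSeries.pderiv ℂ (v n) g = 0) :
    cutJoin v (schur v ν * g) = (kappa ν : ℂ) • (schur v ν * g) := by
  rw [schur, Finset.sum_mul, cutJoin_sum hv, Finset.smul_sum]
  have h : ∀ σ : Perm (Fin ν.card),
      cutJoin v ((irrepCharacter ν σ / ν.card.factorial) • permMonomial v σ * g) =
        ∑ x, ∑ y, if x = y then 0 else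
          (irrepCharacter ν σ / ν.card.factorial) • (permMonomial v (swap x y * σ) * g) := by
    intro σ
    rw [smul_mul_assoc, cutJoin_smul, cutJoin_permMonomial_mul hv σ hg]
    simp only [Finset.smul_sum, smul_ite, smul_zero]
  have h' : ∀ σ : Perm (Fin ν.card),
      (kappa ν : ℂ) • ((irrepCharacter ν σ / ν.card.factorial) • permMonomial v σ * g) =
        ∑ x, ∑ y, if x = y then 0 else
          (irrepCharacter ν (swap x y * σ) / ν.card.factorial) • (permMonomial v σ * g) := by
    intro σ
    rw [smul_mul_assoc, smul_smul, mul_div_assoc', ← sum_irrepCharacter_swap_mul, Finset.sum_div,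
      Finset.sum_smul]
    refine Finset.sum_congr rfl fun x _ => ?_
    rw [Finset.sum_div, Finset.sum_smul]
    refine Finset.sum_congr rfl fun y _ => ?_
    split_ifs
    · rw [zero_div, zero_smul]
    · rfl
  simp only [h, h']
  rw [Finset.sum_comm]
  conv_rhs => rw [Finset.sum_comm]
  refine Finset.sum_congr rfl fun x _ => ?_
  rw [Finset.sum_comm]
  conv_rhs => rw [Finset.sum_comm]
  refine Finset.sum_congr rfl fun y _ => ?_
  refine Fintype.sum_equiv (Equiv.mulLeft (swap x y)) _ _ fun σ => ?_
  simp only [Equiv.coe_mulLeft, swap_mul_self_mul]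

/-! ### Cycle types and partitions -/

theorem prod_orbits_eq_prod_cycleType {α : Type*} [Fintype α] [DecidableEq α] {M : Type*}
    [CommMonoid M] (σ : Perm α) (f : ℕ → M) :
    ∏ A ∈ orbits σ, f A.card = (σ.partition.parts.map f).prod := by
  have hsupp : ∀ x ∈ σ.support, orbit σ x = (σ.cycleOf x).support := by
    intro x hx
    ext y
    rw [mem_orbit, Perm.mem_support_cycleOf_iff, and_iff_left hx]
  have hfix : ∀ x ∉ σ.support, orbit σ x = {x} := by
    intro x hx
    rw [Perm.notMem_support] at hx
    refine Finset.Subset.antisymm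
      (orbit_subset_of_invariant (fun z hz => ?_) (mem_singleton_self x)) ?_
    · rw [mem_singleton] at hz ⊢
      rw [hz, hx]
    · exact singleton_subset_iff.2 (self_mem_orbit σ x)
  have hset : orbits σ =
      σ.cycleFactorsFinset.image Perm.support ∪ σ.supportᶜ.image fun x => ({x} : Finset α) := by
    ext A
    simp only [mem_union, mem_image, mem_compl]
    constructor
    · intro hA
      obtain ⟨x, -, rfl⟩ := mem_image.1 hA
      by_cases hx : x ∈ σ.support
      · exact Or.inl ⟨σ.cycleOf x, Perm.cycleOf_mem_cycleFactorsFinset_iff.2 hx, (hsupp x hx).symm⟩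
      · exact Or.inr ⟨x, hx, (hfix x hx).symm⟩
    · rintro (⟨c, hc, rfl⟩ | ⟨x, hx, rfl⟩)
      · obtain ⟨x, hx⟩ := (Perm.mem_cycleFactorsFinset_iff.1 hc).1.nonempty_support
        have hx' := Perm.mem_cycleFactorsFinset_support_le hc hx
        rw [Perm.cycle_is_cycleOf hx hc, ← hsupp x hx']
        exact orbit_mem_orbits σ x
      · rw [← hfix x hx]
        exact orbit_mem_orbits σ x
  have hdisj : Disjoint (σ.cycleFactorsFinset.image Perm.support)
      (σ.supportᶜ.image fun x => ({x} : Finset α)) := by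
    rw [Finset.disjoint_left]
    intro A hA hA'
    obtain ⟨c, hc, rfl⟩ := mem_image.1 hA
    obtain ⟨x, -, hx⟩ := mem_image.1 hA'
    exact Perm.card_support_ne_one c (by rw [← hx, card_singleton])
  have hinj : Set.InjOn Perm.support (σ.cycleFactorsFinset : Set (Perm α)) := by
    intro c hc d hd h
    obtain ⟨x, hx⟩ := (Perm.mem_cycleFactorsFinset_iff.1 hc).1.nonempty_support
    rw [Perm.cycle_is_cycleOf hx hc, Perm.cycle_is_cycleOf (h ▸ hx) hd]
  rw [hset, Finset.prod_union hdisj, Finset.prod_image hinj,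
    Finset.prod_image (fun _ _ _ _ h => singleton_injective h), Perm.parts_partition,
    Multiset.map_add, Multiset.prod_add, Perm.cycleType_def, Multiset.map_map]
  simp only [card_singleton, Finset.prod_const, Multiset.map_replicate, Multiset.prod_replicate,
    card_compl]
  rfl

theorem pMonomial_eq_prod_rowLens (v : ℕ+ → Var) (μ : YoungDiagram) :
    pMonomial v μ = ((μ.rowLens : Multiset ℕ).map (pVar v)).prod := by
  rw [Multiset.map_coe, Multiset.prod_coe, YoungDiagram.rowLens, List.map_map, pMonomial, length,
    Finset.prod_range, ← List.prod_ofFn]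
  congr 1
  apply List.ext_getElem <;> simp [pVar]

theorem rowLens_injective : Function.Injective YoungDiagram.rowLens := fun _ _ h =>
  YoungDiagram.equivListRowLens.injective (Subtype.ext h)

/-- The rows of length one make up whatever the longer rows leave of `|μ|`. -/
theorem rowLens_eq_filter_add_replicate (μ : YoungDiagram) :
    (μ.rowLens : Multiset ℕ) = (μ.rowLens : Multiset ℕ).filter (2 ≤ ·) +
      Multiset.replicate (μ.card - ((μ.rowLens : Multiset ℕ).filter (2 ≤ ·)).sum) 1 := by
  have h := Multiset.filter_add_not (fun k => 2 ≤ k) (μ.rowLens : Multiset ℕ)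
  have h1 : (μ.rowLens : Multiset ℕ).filter (fun k => ¬ 2 ≤ k) =
      Multiset.replicate ((μ.rowLens : Multiset ℕ).filter (fun k => ¬ 2 ≤ k)).card 1 := by
    rw [Multiset.eq_replicate_card]
    intro k hk
    obtain ⟨hk, hk2⟩ := Multiset.mem_filter.1 hk
    have := μ.pos_of_mem_rowLens k (by simpa using hk)
    omega
  have hs := congrArg Multiset.sum h
  rw [Multiset.sum_add, Multiset.sum_coe, sum_rowLens, h1, Multiset.sum_replicate, smul_eq_mul,
    mul_one] at hs
  have h2 : μ.card - ((μ.rowLens : Multiset ℕ).filter (2 ≤ ·)).sum =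
      ((μ.rowLens : Multiset ℕ).filter (fun k => ¬ 2 ≤ k)).card := by omega
  rw [h2, ← h1, h]

theorem parts_partition_eq_rowLens_iff {α : Type*} [Fintype α] [DecidableEq α] {σ : Perm α}
    {μ : YoungDiagram} (hμ : μ.card = Fintype.card α) :
    σ.partition.parts = μ.rowLens ↔
      σ.cycleType = (μ.rowLens : Multiset ℕ).filter (2 ≤ ·) := by
  constructor
  · intro h
    rw [← h, Perm.filter_parts_partition_eq_cycleType]
  · intro h
    rw [Perm.parts_partition, ← Perm.sum_cycleType, rowLens_eq_filter_add_replicate μ, ← h, hμ]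

/-- The Young diagram whose rows are the cycle lengths of a permutation. -/
def cycleDiagram {α : Type*} [Fintype α] [DecidableEq α] (σ : Perm α) : YoungDiagram :=
  YoungDiagram.ofRowLens (σ.partition.parts.sort (· ≥ ·))
    (σ.partition.parts.pairwise_sort (· ≥ ·)).sortedGE

theorem coe_rowLens_cycleDiagram {α : Type*} [Fintype α] [DecidableEq α] (σ : Perm α) :
    ((cycleDiagram σ).rowLens : Multiset ℕ) = σ.partition.parts := by
  rw [cycleDiagram, YoungDiagram.rowLens_ofRowLens_eq_self, Multiset.sort_eq]
  intro x hx
  exact σ.partition.parts_pos (Multiset.mem_sort _ |>.1 hx)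

theorem card_cycleDiagram {α : Type*} [Fintype α] [DecidableEq α] (σ : Perm α) :
    (cycleDiagram σ).card = Fintype.card α := by
  rw [← sum_rowLens, ← Multiset.sum_coe, coe_rowLens_cycleDiagram, σ.partition.parts_sum]

theorem cycleDiagram_eq_iff {α : Type*} [Fintype α] [DecidableEq α] {σ : Perm α}
    {μ : YoungDiagram} (hμ : μ.card = Fintype.card α) :
    cycleDiagram σ = μ ↔ σ.cycleType = (μ.rowLens : Multiset ℕ).filter (2 ≤ ·) := by
  rw [← parts_partition_eq_rowLens_iff hμ, ← coe_rowLens_cycleDiagram]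
  constructor
  · rintro rfl
    rfl
  · intro h
    exact rowLens_injective ((Multiset.coe_eq_coe.1 h).eq_of_sortedGE
      (YoungDiagram.rowLens_sorted _) (YoungDiagram.rowLens_sorted _))

theorem zFactor_eq (μ : YoungDiagram) {m : Multiset ℕ}
    (hm : m = (μ.rowLens : Multiset ℕ).filter (2 ≤ ·)) :
    zFactor μ = (μ.card - m.sum).factorial * m.prod *
      ∏ n ∈ m.toFinset, (m.count n).factorial := by
  have h := rowLens_eq_filter_add_replicate μ
  rw [← hm] at h
  set r := μ.card - m.sum
  have h1 : (1 : ℕ) ∉ m.toFinset := by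
    rw [Multiset.mem_toFinset, hm, Multiset.mem_filter]
    omega
  have hcount : ∀ j, μ.rowLens.count j = m.count j + if j = 1 then r else 0 := by
    intro j
    rw [← Multiset.coe_count, h, Multiset.count_add, Multiset.count_replicate]
    simp only [eq_comm]
  have hsub : μ.rowLens.toFinset ⊆ insert 1 m.toFinset := by
    intro j hj
    have hj : j ∈ (μ.rowLens : Multiset ℕ) := by simpa using hj
    rw [h, Multiset.mem_add] at hj
    rw [mem_insert, Multiset.mem_toFinset]
    exact hj.symm.imp Multiset.eq_of_mem_replicate id
  have hz : zFactor μ = ∏ j ∈ insert 1 m.toFinset,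
      (μ.rowLens.count j).factorial * j ^ μ.rowLens.count j := by
    refine Finset.prod_subset hsub fun j _ hj => ?_
    rw [List.count_eq_zero_of_not_mem fun h => hj (List.mem_toFinset.2 h)]
    simp
  rw [hz, Finset.prod_insert h1, hcount, if_pos rfl, one_pow, mul_one,
    Multiset.count_eq_zero_of_notMem (fun h => h1 (Multiset.mem_toFinset.2 h)), zero_add, mul_assoc,
    Finset.prod_multiset_count, ← Finset.prod_mul_distrib]
  congr 1
  refine Finset.prod_congr rfl fun j hj => ?_
  have hj1 : j ≠ 1 := by rintro rfl; exact h1 hj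
  rw [hcount, if_neg hj1, add_zero, mul_comm]

open Classical in
/-- The conjugacy class of cycle type `μ` has `d! / z_μ` elements. -/
theorem card_cycleDiagram_eq_mul_zFactor {α : Type*} [Fintype α] [DecidableEq α]
    {μ : YoungDiagram} (hμ : μ.card = Fintype.card α) :
    (univ.filter fun σ : Perm α => cycleDiagram σ = μ).card * zFactor μ =
      (Fintype.card α).factorial := by
  have h := Perm.card_of_cycleType_mul_eq α ((μ.rowLens : Multiset ℕ).filter (2 ≤ ·))
  rw [if_pos, ← hμ, ← zFactor_eq μ rfl, hμ] at h
  · simpa only [cycleDiagram_eq_iff hμ] using h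
  · refine ⟨?_, fun a ha => (Multiset.mem_filter.1 ha).2⟩
    have hs := congrArg Multiset.sum (rowLens_eq_filter_add_replicate μ)
    rw [Multiset.sum_add, Multiset.sum_coe, sum_rowLens, hμ] at hs
    omega

/-- The diagrams with at most `N` boxes. -/
def diagramsUpTo (N : ℕ) : Finset YoungDiagram := (finite_card_le N).toFinset

theorem mem_diagramsUpTo {N : ℕ} {μ : YoungDiagram} : μ ∈ diagramsUpTo N ↔ μ.card ≤ N := by
  simp [diagramsUpTo]

/-- `χ_ν(μ)`, extended by zero to `|μ| ≠ |ν|`. -/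
def extendedChi (ν μ : YoungDiagram) : ℂ := if h : μ.card = ν.card then chi ν μ h else 0

theorem schur_eq_sum (v : ℕ+ → Var) {ν : YoungDiagram} {N : ℕ} (hN : ν.card ≤ N) :
    schur v ν = ∑ μ ∈ diagramsUpTo N, (extendedChi ν μ / zFactor μ) • pMonomial v μ := by
  classical
  have hmaps : ∀ σ ∈ (univ : Finset (Perm (Fin ν.card))), cycleDiagram σ ∈ diagramsUpTo N := by
    intro σ _
    rw [mem_diagramsUpTo, card_cycleDiagram, Fintype.card_fin]
    exact hN
  rw [schur, ← Finset.sum_fiberwise_of_maps_to hmaps]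
  refine Finset.sum_congr rfl fun μ _ => ?_
  by_cases hμ : μ.card = ν.card
  · have hμ' : μ.card = Fintype.card (Fin ν.card) := by rw [Fintype.card_fin, hμ]
    have hcard := card_cycleDiagram_eq_mul_zFactor hμ'
    rw [Fintype.card_fin] at hcard
    have hterm : ∀ σ ∈ univ.filter fun σ : Perm (Fin ν.card) => cycleDiagram σ = μ,
        (irrepCharacter ν σ / ν.card.factorial) • permMonomial v σ =
          (chi ν μ hμ / ν.card.factorial) • pMonomial v μ := by
      intro σ hσ
      have hσ := (mem_filter.1 hσ).2
      have hchi : irrepCharacter ν σ = chi ν μ hμ :=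
        irrepCharacter_eq_of_isConj (Perm.isConj_iff_cycleType_eq.2
          (((cycleDiagram_eq_iff hμ').1 hσ).trans (exists_perm ν μ hμ).choose_spec.symm))
      rw [hchi, permMonomial, prod_orbits_eq_prod_cycleType, ← coe_rowLens_cycleDiagram, hσ,
        ← pMonomial_eq_prod_rowLens]
    rw [Finset.sum_congr rfl hterm, Finset.sum_const, ← Nat.cast_smul_eq_nsmul ℂ, smul_smul,
      extendedChi, dif_pos hμ]
    congr 1
    have hf : (ν.card.factorial : ℂ) ≠ 0 := Nat.cast_ne_zero.2 (Nat.factorial_ne_zero _)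
    rw [← hcard, Nat.cast_mul] at hf ⊢
    have h1 := left_ne_zero_of_mul hf
    have h2 := right_ne_zero_of_mul hf
    field_simp
  · rw [extendedChi, dif_neg hμ, zero_div, zero_smul]
    refine Finset.sum_eq_zero fun σ hσ => absurd ?_ hμ
    rw [← (mem_filter.1 hσ).2, card_cycleDiagram, Fintype.card_fin]

/-! ### The generating series in a bounded degree -/

/-- The quadruples of partitions of size at most `N`. -/
def quadruplesUpTo (N : ℕ) : Finset Quadruple :=
  ((diagramsUpTo N ×ˢ diagramsUpTo N) ×ˢ (diagramsUpTo N ×ˢ diagramsUpTo N)).subtype _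

theorem coeff_RTerm_eq_zero {lam tau : ℂ} {N : ℕ} {x : Quadruple} (hx : x ∉ quadruplesUpTo N)
    {m : Var →₀ ℕ} (hm : degree m ≤ N) : MvPowerSeries.coeff m (RTerm lam tau x) = 0 := by
  classical
  obtain ⟨⟨⟨μ, ν⟩, μ', ν'⟩, hc, hc'⟩ := x
  rw [RTerm, MvPowerSeries.coeff_smul, pMonomial_eq, pMonomial_eq,
    MvPowerSeries.monomial_mul_monomial, MvPowerSeries.coeff_monomial, if_neg, mul_zero]
  rintro rfl
  rw [degree_add, degree_pExponent (fun _ => rfl), degree_pExponent (fun _ => rfl)] at hm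
  apply hx
  change μ.card = ν.card at hc
  change μ'.card = ν'.card at hc'
  simp only [quadruplesUpTo, mem_subtype, mem_product, mem_diagramsUpTo]
  change μ.card + μ'.card ≤ N at hm
  omega

theorem coeff_R {lam tau : ℂ} {N : ℕ} {m : Var →₀ ℕ} (hm : degree m ≤ N) :
    MvPowerSeries.coeff m (R lam tau) =
      MvPowerSeries.coeff m (∑ x ∈ quadruplesUpTo N, RTerm lam tau x) := by
  rw [R, coeff_formalSum, map_sum]
  refine finsum_eq_sum_of_support_subset _ fun x hx => ?_
  by_contra h
  exact hx (coeff_RTerm_eq_zero h hm)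

theorem sum_quadruples_eq_sum_schur {N : ℕ} (w : YoungDiagram → YoungDiagram → ℂ) :
    ∑ x ∈ quadruplesUpTo N,
      (chi x.1.1.2 x.1.1.1 x.2.1 / zFactor x.1.1.1 * (chi x.1.2.2 x.1.2.1 x.2.2 / zFactor x.1.2.1) *
        w x.1.1.2 x.1.2.2) • (pMonomial Sum.inl x.1.1.1 * pMonomial Sum.inr x.1.2.1) =
      ∑ ν ∈ diagramsUpTo N, ∑ ν' ∈ diagramsUpTo N,
        w ν ν' • (schur Sum.inl ν * schur Sum.inr ν') := by
  let G : (YoungDiagram × YoungDiagram) × (YoungDiagram × YoungDiagram) → Series := fun x =>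
    (extendedChi x.1.2 x.1.1 / zFactor x.1.1 * (extendedChi x.2.2 x.2.1 / zFactor x.2.1) *
      w x.1.2 x.2.2) • (pMonomial Sum.inl x.1.1 * pMonomial Sum.inr x.2.1)
  have hG : ∀ x : Quadruple,
      (chi x.1.1.2 x.1.1.1 x.2.1 / zFactor x.1.1.1 * (chi x.1.2.2 x.1.2.1 x.2.2 / zFactor x.1.2.1) *
        w x.1.1.2 x.1.2.2) • (pMonomial Sum.inl x.1.1.1 * pMonomial Sum.inr x.1.2.1) = G x.1 := by
    intro x
    simp only [G, extendedChi]
    rw [dif_pos x.2.1, dif_pos x.2.2]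
  simp only [hG]
  rw [quadruplesUpTo, Finset.sum_subtype_eq_sum_filter, Finset.sum_filter_of_ne]
  · rw [Finset.sum_product, Finset.sum_product_right]
    refine Finset.sum_congr rfl fun ν hν => ?_
    simp only [Finset.sum_product_right]
    rw [Finset.sum_comm]
    refine Finset.sum_congr rfl fun ν' hν' => ?_
    rw [schur_eq_sum _ (mem_diagramsUpTo.1 hν), schur_eq_sum _ (mem_diagramsUpTo.1 hν'),
      Finset.sum_mul, Finset.smul_sum]
    refine Finset.sum_congr rfl fun μ _ => ?_
    rw [Finset.mul_sum, Finset.smul_sum]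
    refine Finset.sum_congr rfl fun μ' _ => ?_
    simp only [G]
    rw [smul_mul_smul_comm, smul_smul]
    congr 1
    ring
  · intro x _ hx
    by_contra hne
    apply hx
    rw [not_and_or] at hne
    simp only [G, extendedChi]
    rcases hne with h | h <;> simp [h]

theorem pderiv_schur_of_forall_ne {v : ℕ+ → Var} {x : Var} (h : ∀ k, v k ≠ x) (ν : YoungDiagram) :
    MvPowerSeries.pderiv ℂ x (schur v ν) = 0 := by
  rw [schur, map_sum]
  refine Finset.sum_eq_zero fun σ _ => ?_
  rw [Derivation.map_smul, permMonomial]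
  have key : ∀ s : Finset (Finset (Fin ν.card)),
      MvPowerSeries.pderiv ℂ x (∏ A ∈ s, pVar v A.card) = 0 := by
    intro s
    induction s using Finset.induction_on with
    | empty => rw [Finset.prod_empty, MvPowerSeries.pderiv_one]
    | insert B s hB ih =>
      rw [Finset.prod_insert hB, Derivation.leibniz, ih, pVar,
        MvPowerSeries.pderiv_X_of_ne (h _), smul_zero, smul_zero, add_zero]
  rw [key, smul_zero]

/-- In each degree the cut-and-join operator only sees the finitely many terms of the generating
series in that degree. -/
theorem coeff_cutJoin_R {v : ℕ+ → Var} (hv : Function.Injective v)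
    (hdeg : ∀ n, Sum.elim PNat.val PNat.val (v n) = (n : ℕ)) (lam tau : ℂ) {N : ℕ}
    {m : Var →₀ ℕ} (hm : degree m ≤ N) :
    MvPowerSeries.coeff m (cutJoin v (R lam tau)) =
      MvPowerSeries.coeff m (cutJoin v (∑ x ∈ quadruplesUpTo N, RTerm lam tau x)) := by
  set F := ∑ x ∈ quadruplesUpTo N, RTerm lam tau x with hF
  have h : VanishesBelow (N + 1) (R lam tau + (-1 : ℂ) • F) := by
    intro m' hm'
    rw [map_add, MvPowerSeries.coeff_smul, coeff_R (Nat.lt_succ_iff.1 hm')]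
    ring
  have h2 := h.cutJoin hdeg m (Nat.lt_succ_iff.2 hm)
  have h3 := cutJoin_sum hv (univ : Finset Bool)
    fun b => if b then R lam tau else (-1 : ℂ) • F
  simp only [Fintype.sum_bool, if_true, Bool.false_eq_true, if_false] at h3
  rw [h3, cutJoin_smul, map_add, MvPowerSeries.coeff_smul] at h2
  linear_combination h2

/-- The weight of `s_{ν⁺}(p⁺) s_{ν⁻}(p⁻)` in the generating series. -/
def weight (lam tau : ℂ) (ν ν' : YoungDiagram) : ℂ :=
  Complex.exp (Complex.I * (kappa ν * tau + kappa ν' / tau) * lam / 2) * W₂ lam ν ν'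

theorem RTerm_eq (lam tau : ℂ) (x : Quadruple) :
    RTerm lam tau x = (chi x.1.1.2 x.1.1.1 x.2.1 / zFactor x.1.1.1 *
      (chi x.1.2.2 x.1.2.1 x.2.2 / zFactor x.1.2.1) * weight lam tau x.1.1.2 x.1.2.2) •
        (pMonomial Sum.inl x.1.1.1 * pMonomial Sum.inr x.1.2.1) := by
  rw [RTerm, weight, mul_assoc (_ * _) (Complex.exp _)]

theorem cutJoin_inl_sum_RTerm (lam tau : ℂ) (N : ℕ) :
    cutJoin Sum.inl (∑ x ∈ quadruplesUpTo N, RTerm lam tau x) =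
      ∑ x ∈ quadruplesUpTo N, (kappa x.1.1.2 : ℂ) • RTerm lam tau x := by
  simp only [RTerm_eq, smul_smul, mul_left_comm (kappa _ : ℂ)]
  rw [sum_quadruples_eq_sum_schur (weight lam tau),
    sum_quadruples_eq_sum_schur fun ν ν' => (kappa ν : ℂ) * weight lam tau ν ν',
    cutJoin_sum Sum.inl_injective]
  refine Finset.sum_congr rfl fun ν _ => ?_
  rw [cutJoin_sum Sum.inl_injective]
  refine Finset.sum_congr rfl fun ν' _ => ?_
  rw [cutJoin_smul, cutJoin_schur_mul Sum.inl_injective ν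
    fun n => pderiv_schur_of_forall_ne (fun k => Sum.inr_ne_inl) ν', smul_smul, mul_comm]

theorem cutJoin_inr_sum_RTerm (lam tau : ℂ) (N : ℕ) :
    cutJoin Sum.inr (∑ x ∈ quadruplesUpTo N, RTerm lam tau x) =
      ∑ x ∈ quadruplesUpTo N, (kappa x.1.2.2 : ℂ) • RTerm lam tau x := by
  simp only [RTerm_eq, smul_smul, mul_left_comm (kappa _ : ℂ)]
  rw [sum_quadruples_eq_sum_schur (weight lam tau),
    sum_quadruples_eq_sum_schur fun ν ν' => (kappa ν' : ℂ) * weight lam tau ν ν',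
    cutJoin_sum Sum.inr_injective]
  refine Finset.sum_congr rfl fun ν _ => ?_
  rw [cutJoin_sum Sum.inr_injective]
  refine Finset.sum_congr rfl fun ν' _ => ?_
  rw [cutJoin_smul, mul_comm (schur _ ν), cutJoin_schur_mul Sum.inr_injective ν'
    fun n => pderiv_schur_of_forall_ne (fun k => Sum.inl_ne_inr) ν, smul_smul,
    mul_comm (weight lam tau ν ν')]

theorem hasDerivAt_coeff_RTerm (lam : ℂ) {tau : ℂ} (htau : tau ≠ 0) (m : Var →₀ ℕ)
    (x : Quadruple) :
    HasDerivAt (fun t => MvPowerSeries.coeff m (RTerm lam t x))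
      ((Complex.I * lam / 2 * kappa x.1.1.2 - Complex.I * lam / (2 * tau ^ 2) * kappa x.1.2.2) *
        MvPowerSeries.coeff m (RTerm lam tau x)) tau := by
  simp only [RTerm, MvPowerSeries.coeff_smul]
  have h1 : HasDerivAt (fun t : ℂ => (kappa x.1.1.2 : ℂ) * t + kappa x.1.2.2 / t)
      (kappa x.1.1.2 - kappa x.1.2.2 / tau ^ 2) tau := by
    have := ((hasDerivAt_id tau).const_mul (kappa x.1.1.2 : ℂ)).add
      ((hasDerivAt_inv htau).const_mul (kappa x.1.2.2 : ℂ))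
    refine HasDerivAt.congr_deriv this ?_
    ring
  have h2 := ((((h1.const_mul Complex.I).mul_const lam).div_const 2).cexp.const_mul
    ((chi x.1.1.2 x.1.1.1 x.2.1 / zFactor x.1.1.1) *
      (chi x.1.2.2 x.1.2.1 x.2.2 / zFactor x.1.2.1))).mul_const (W₂ lam x.1.1.2 x.1.2.2)
  refine HasDerivAt.congr_deriv (h2.mul_const _) ?_
  field_simp

end TwoPartition

end

theorem mainTheorem4 (lam tau : ℂ)
    (hlam : ∀ n : ℕ, 0 < n → Complex.exp (Complex.I * lam * n) ≠ 1) (htau : tau ≠ 0)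
    (m : TwoPartition.Var →₀ ℕ) :
    HasDerivAt (fun t : ℂ => MvPowerSeries.coeff m (TwoPartition.R lam t))
      (MvPowerSeries.coeff m
        ((Complex.I * lam / 2) •
            (TwoPartition.cut Sum.inl (TwoPartition.R lam tau) +
              TwoPartition.join Sum.inl (TwoPartition.R lam tau)) -
          (Complex.I * lam / (2 * tau ^ 2)) •
            (TwoPartition.cut Sum.inr (TwoPartition.R lam tau) +
              TwoPartition.join Sum.inr (TwoPartition.R lam tau))))
      tau := by
  open TwoPartition in
  have hR : (fun t : ℂ => MvPowerSeries.coeff m (R lam t)) =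
      fun t => ∑ x ∈ quadruplesUpTo (degree m), MvPowerSeries.coeff m (RTerm lam t x) := by
    funext t
    rw [coeff_R le_rfl, map_sum]
  rw [hR]
  refine HasDerivAt.congr_deriv
    (HasDerivAt.fun_sum fun x _ => TwoPartition.hasDerivAt_coeff_RTerm lam htau m x) ?_
  change _ = MvPowerSeries.coeff m
    ((Complex.I * lam / 2) • TwoPartition.cutJoin Sum.inl (TwoPartition.R lam tau) -
      (Complex.I * lam / (2 * tau ^ 2)) • TwoPartition.cutJoin Sum.inr (TwoPartition.R lam tau))
  rw [map_sub, MvPowerSeries.coeff_smul, MvPowerSeries.coeff_smul,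
    TwoPartition.coeff_cutJoin_R Sum.inl_injective (fun _ => rfl) lam tau le_rfl,
    TwoPartition.coeff_cutJoin_R Sum.inr_injective (fun _ => rfl) lam tau le_rfl,
    TwoPartition.cutJoin_inl_sum_RTerm, TwoPartition.cutJoin_inr_sum_RTerm, map_sum, map_sum,
    Finset.mul_sum, Finset.mul_sum, ← Finset.sum_sub_distrib]
  refine Finset.sum_congr rfl fun x _ => ?_
  rw [MvPowerSeries.coeff_smul, MvPowerSeries.coeff_smul]
  ring
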